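/- **Model.** The network is a finite simple undirected graph $G=(V,E)$, not necessarily connected, with $|V|\le n$. All nodes know $n$. Every node has a unique identifier in $\{0,\dots,n^a-1\}$, where $a$ is a constant (so identifiers have $O(\log n)$ bits), and numbers its incident edges by ports in an arbitrary way. In the $\mathsf{CONGEST}$ model with shared randomness and no private randomness, all nodes run the same deterministic algorithm. Initially a node knows only $n$, its identifier, its degree, and a string of $s(n)$ independent unbiased random bits, which is the same string for all nodes. In each synchronous round every node sends one message of at most $b(n)=O(\log n)$ bits to each neighbor. Local computation is free. **Network decompositions.** A network decomposition of $G$ with $\alpha$ colors, diameter $\beta$ and congestion $\kappa$ (an $(\alpha,\beta)$-network decomposition with congestion $\kappa$) is a partition of $V$ into clusters $C_1,\dots,C_p$, together with a subtree $T_i$ of $G$ and a color $\gamma_i\in\{1,\dots,\alpha\}$ for each $i$, such that $T_i$ contains all nodes of $C_i$ (and possibly other nodes) and has diameter at most $\beta$, any two distinct clusters joined by an edge of $G$ have different colors, and for each color $j$ every node lies in at most $\kappa$ of the trees $T_i$ with $\gamma_i=j$. An algorithm builds such a decomposition if at the end every node outputs a name of its cluster (the same for all nodes of the cluster, different for different clusters),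 the color of its cluster, and, for each of its incident edges, the names of the clusters whose trees contain this edge. **Theorem.** With only $\mathrm{poly}(\log n)$ bits of shared randomness and no private randomness, an $(O(\log n),O(\log^2 n))$-network decomposition with congestion $1$ can be built in $\mathrm{poly}(\log n)$ rounds of the $\mathsf{CONGEST}$ model, with high probability. Precisely, there is a constant $e$ such that for every constant $c$ there is a constant $K$ such that for every constant $a$ there are a constant $C$ and an algorithm in the above model which, for every $n\ge 2$, uses $s(n)\le C\log^{e} n$ shared random bits, at most $C\log^{e} n$ rounds, and messages of at most $C\log n$ bits, and for which the following holds. For every $n\ge2$, every graph $G$ with at most $n$ nodes, every assignment of unique identifiers from $\{0,\dots,n^a-1\}$ and every port numbering, with probability at least $1-n^{-c}$ over the shared random bits, the algorithm builds a network decomposition of $G$ with at most $K\log n$ colors, tree diameter at most $K\log^2 n$, and congestion $1$. (Here $\log n$ may be read as $\lfloor\log_2 n\rfloor$.) -/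

import Mathlib

/-- The data of a network decomposition of `G`. Clusters are named by natural numbers:
`cluster v` is the name of the cluster of `v`, so that the clusters are the nonempty fibres of
`cluster`, and they partition `V`. `color l` and `tree l` are the color and the tree of the cluster
named `l`; their values at names outside `Set.range cluster` play no role. -/
structure ClusterData {V : Type*} (G : SimpleGraph V) where
  cluster : V → ℕ
  color : ℕ → ℕ
  tree : ℕ → G.Subgraph

/-- `D` is a network decomposition of `G` with colors in `{1, …, numColors}`, trees of diameter at
most `diam`, and congestion at most `congestion`: every node lies in the trees of at most
`congestion` clusters of each color. The tree of a cluster is a subtree of `G` that contains the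
cluster; it may contain further nodes. -/
structure IsNetworkDecomposition {V : Type*} {G : SimpleGraph V} (D : ClusterData G)
    (numColors diam congestion : ℕ) : Prop where
  isTree : ∀ l ∈ Set.range D.cluster, (D.tree l).coe.IsTree
  spans : ∀ v : V, v ∈ (D.tree (D.cluster v)).verts
  diam_le : ∀ l ∈ Set.range D.cluster, ∀ x y : (D.tree l).verts, (D.tree l).coe.dist x y ≤ diam
  color_mem : ∀ l ∈ Set.range D.cluster, D.color l ∈ Finset.Icc 1 numColors
  color_ne : ∀ u v : V, G.Adj u v → D.cluster u ≠ D.cluster v →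
    D.color (D.cluster u) ≠ D.color (D.cluster v)
  congestion_le : ∀ (v : V) (j : ℕ),
    {l ∈ Set.range D.cluster | D.color l = j ∧ v ∈ (D.tree l).verts}.encard ≤ congestion

/-- A port numbering: every node `v` numbers its incident edges by `0, …, deg v - 1`. -/
abbrev PortNumbering {V : Type*} [Fintype V] (G : SimpleGraph V) [DecidableRel G.Adj] :=
  ∀ v : V, Fin (G.degree v) ≃ G.neighborSet v

/-- What a node outputs: the name and the color of its cluster, and the set of all pairs `(l, p)`
for which its incident edge at port `p` belongs to the tree of the cluster named `l`. -/
structure NodeOutput where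
  cluster : ℕ
  color : ℕ
  treeEdges : Finset (ℕ × ℕ)

/-- The outputs `out v` of the nodes are the local views of the decomposition data `D`. -/
def IsLocalView {V : Type*} [Fintype V] {G : SimpleGraph V} [DecidableRel G.Adj]
    (port : PortNumbering G) (D : ClusterData G) (out : V → NodeOutput) : Prop :=
  ∀ v : V, (out v).cluster = D.cluster v ∧ (out v).color = D.color (D.cluster v) ∧
    ∀ l p : ℕ, (l, p) ∈ (out v).treeEdges ↔
      l ∈ Set.range D.cluster ∧ ∃ hp : p < G.degree v, (D.tree l).Adj v (port v ⟨p, hp⟩)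

/-- A synchronous message passing algorithm in the CONGEST model whose only randomness is a string
of shared random bits, known to all nodes. All nodes run the same deterministic local functions, and
all of them know the parameter `n` (an upper bound on the number of nodes). Initially, a node knows
moreover its identifier, its degree and the shared random string. In every round a node sends
through each of its ports a bit string of length at most `msgBits n`, and then updates its state
from the list of the strings it received, ordered by port. The algorithm runs for `rounds n`
rounds. As usual in this model, local computation is unrestricted. -/
structure SharedRandomCongestAlgorithm where
  sharedBits : ℕ → ℕ
  rounds : ℕ → ℕ
  msgBits : ℕ → ℕ
  State : Type
  init : (n : ℕ) → (ident deg : ℕ) → (Fin (sharedBits n) → Bool) → State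
  send : (n : ℕ) → State → (port : ℕ) → List Bool
  send_length_le : ∀ (n : ℕ) (s : State) (port : ℕ), (send n s port).length ≤ msgBits n
  receive : (n : ℕ) → State → List (List Bool) → State
  output : (n : ℕ) → State → NodeOutput

namespace SharedRandomCongestAlgorithm

/-- The state of each node after `t` rounds on the network `G` with identifiers `ident` and port
numbering `port`, if the parameter is `n` and the shared random string is `r`. -/
def stateAfter (A : SharedRandomCongestAlgorithm) (n : ℕ) {V : Type*} [Fintype V]
    (G : SimpleGraph V) [DecidableRel G.Adj] (ident : V → ℕ) (port : PortNumbering G)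
    (r : Fin (A.sharedBits n) → Bool) : ℕ → V → A.State
  | 0, v => A.init n (ident v) (G.degree v) r
  | t + 1, v => A.receive n (A.stateAfter n G ident port r t v)
      (List.ofFn fun p : Fin (G.degree v) =>
        A.send n (A.stateAfter n G ident port r t (port v p))
          ((port (port v p)).symm ⟨v, (port v p).2.symm⟩ : ℕ))

/-- The output of each node at the end of the execution. -/
def result (A : SharedRandomCongestAlgorithm) (n : ℕ) {V : Type*} [Fintype V]
    (G : SimpleGraph V) [DecidableRel G.Adj] (ident : V → ℕ) (port : PortNumbering G)
    (r : Fin (A.sharedBits n) → Bool) (v : V) : NodeOutput :=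
  A.output n (A.stateAfter n G ident port r (A.rounds n) v)

/-- With shared random string `r`, the nodes output a network decomposition with the given
parameters. -/
def Builds (A : SharedRandomCongestAlgorithm) (n : ℕ) {V : Type*} [Fintype V]
    (G : SimpleGraph V) [DecidableRel G.Adj] (ident : V → ℕ) (port : PortNumbering G)
    (numColors diam congestion : ℕ) (r : Fin (A.sharedBits n) → Bool) : Prop :=
  ∃ D : ClusterData G, IsNetworkDecomposition D numColors diam congestion ∧
    IsLocalView port D (A.result n G ident port r)

end SharedRandomCongestAlgorithm

/-- The probability of an event under `k` independent, unbiased random bits. -/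
noncomputable def probBits {k : ℕ} (P : (Fin k → Bool) → Prop) : ℝ :=
  (Nat.card {r : Fin k → Bool // P r} : ℝ) / 2 ^ k

/-! The nodes are clustered in phases, one color per phase. In a phase every remaining node draws a
truncated geometric radius `ρ` and starts a flood with the value `ρ * M + ident`, where `M` exceeds
all identifiers. Crossing an edge costs `M`, so the limit `f` records two things at once: the
residue modulo `M` is the winning center, the quotient is the radius still left. A second flood,
running inside the region of one center, computes the largest value `g` that enters from another
center. A node joins the cluster of its center if `g + 2 * M ≤ f`.

The margin does two jobs. Adjacent nodes with different centers cannot both have it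
(`center_eq_of_adj`), so clusters of one phase are not adjacent. It also survives the step to a
neighbor of potential `f + M` (`joining_of_isParent`), so every cluster contains its tree of parent
edges. This gives congestion 1 and depth at most `B = O(log n)`; the diameter is in fact `O(log n)`.

A node joins with constant probability by a shifting argument (`joins_of_bump`,
`eighth_le_sum_joins`): adding 2 to the radius of the winning center makes the node join, keeps its
center and divides the weight by 4. The center is unchanged, so the shift is injective, and it is
defined on at least half of the mass.

Independent radii for all nodes would cost too many shared bits. But whether a node joins depends
only on the radii, the active set and the neighborhoods, all of which can be placed on the `2 ^ m`
possible identifiers. A Chernoff bound and a union bound over all such configurations give one fixed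
table of `2 ^ (2 * m + 8)` radius assignments that serves every configuration
(`exists_radiusTable`). Local computation is free, so the table is built into the algorithm, and a
phase uses only a seed of `2 * m + 8` bits. The seed is independent of the nodes left over so far,
so their expected number shrinks by `15 / 16` per phase, and Markov's inequality finishes the proof.
-/

/-- `f` solves the equation of a flood in which every node `x` starts with the value `key x` and
values decrease by `M` whenever they are passed on to `x` by a member of `R x`. -/
def IsPotential {α : Type*} (M : ℕ) (R : α → Finset α) (key f : α → ℕ) : Prop :=
  ∀ x, f x = max (key x) ((R x).sup fun y => f y - M)

/-! ### Potentials: tracing values back, and uniqueness -/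

namespace IsPotential

variable {α : Type*} {M : ℕ} {R : α → Finset α} {key f f' : α → ℕ}

theorem key_le (h : IsPotential M R key f) (x : α) : key x ≤ f x := by
  rw [h x]; exact le_max_left _ _

theorem le_add (h : IsPotential M R key f) {x y : α} (hy : y ∈ R x) : f y ≤ f x + M := by
  have h1 : f y - M ≤ (R x).sup fun y => f y - M := Finset.le_sup (f := fun y => f y - M) hy
  have h2 := h x
  omega

/-- The supremum is over a finite set, so it is attained. Iterating the second alternative traces a
path back to the node whose key produced the value. -/
theorem eq_key_or_exists (h : IsPotential M R key f) (x : α) :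
    f x = key x ∨ ∃ y ∈ R x, f y = f x + M := by
  by_cases hx : f x = key x
  · exact Or.inl hx
  right
  have hk := h.key_le x
  have hsup : f x = (R x).sup fun y => f y - M := by
    have := h x
    omega
  have hne : (R x).Nonempty := by
    by_contra hne
    rw [Finset.not_nonempty_iff_eq_empty] at hne
    simp [hne] at hsup
    omega
  obtain ⟨y, hy, hy'⟩ := Finset.exists_mem_eq_sup (R x) hne (fun y => f y - M)
  refine ⟨y, hy, ?_⟩
  omega

/-- Each backward step raises the value by `M > 0`, and the values are bounded, so the trace must
end at a node that has its own key. -/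
theorem induction [Finite α] (hM : 0 < M) (h : IsPotential M R key f) {P : α → Prop}
    (base : ∀ x, f x = key x → P x) (step : ∀ x, ∀ y ∈ R x, f y = f x + M → P y → P x)
    (x : α) : P x := by
  obtain ⟨b, hb⟩ := (Set.finite_range f).bddAbove
  have hb' : ∀ y, f y ≤ b := fun y => hb ⟨y, rfl⟩
  suffices H : ∀ k x, b - f x ≤ k → P x from H _ x le_rfl
  intro k
  induction k with
  | zero =>
    intro x hx
    rcases h.eq_key_or_exists x with h1 | ⟨y, -, h1⟩
    · exact base x h1
    · have := hb' y
      omega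
  | succ k ih =>
    intro x hx
    rcases h.eq_key_or_exists x with h1 | ⟨y, hy, h1⟩
    · exact base x h1
    · have := hb' y
      exact step x y hy h1 (ih y (by omega))

theorem le_of_isPotential [Finite α] (hM : 0 < M) (h : IsPotential M R key f)
    (h' : IsPotential M R key f') : f ≤ f' := by
  refine h.induction hM (P := fun x => f x ≤ f' x) (fun x hx => hx ▸ h'.key_le x) ?_
  intro x y hy hxy hle
  have := h'.le_add hy
  omega

theorem unique [Finite α] (hM : 0 < M) (h : IsPotential M R key f)
    (h' : IsPotential M R key f') : f = f' :=
  le_antisymm (h.le_of_isPotential hM h') (h'.le_of_isPotential hM h)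

end IsPotential

/-! ### Convergence of the flood -/

section Flood

variable {α : Type*} {M : ℕ} {R : α → Finset α} {key : α → ℕ}

/-- The larger maximum exceeds `k` and is positive, so it comes from a member `y` at which the
truncated subtraction is a genuine one. -/
theorem exists_of_max_sup_tsub_lt {s : Finset α} {h h' : α → ℕ} {k : ℕ}
    (hlt : max k (s.sup fun y => h' y - M) < max k (s.sup fun y => h y - M)) :
    ∃ y ∈ s, h y = max k (s.sup fun y => h y - M) + M ∧ h' y < h y := by
  have hne : s.Nonempty := by
    by_contra hne
    rw [Finset.not_nonempty_iff_eq_empty] at hne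
    simp [hne] at hlt
  obtain ⟨y, hy, hy'⟩ := Finset.exists_mem_eq_sup s hne (fun y => h y - M)
  have h2 : h' y - M ≤ s.sup fun y => h' y - M := Finset.le_sup (f := fun y => h' y - M) hy
  refine ⟨y, hy, ?_, ?_⟩ <;> omega

/-- Iterating the flood equation from bounded values, the values that still change after `i` steps
are small. -/
theorem flood_change_lt {h : ℕ → α → ℕ} {b t : ℕ}
    (hstep : ∀ i < t, ∀ x, h (i + 1) x = max (key x) ((R x).sup fun y => h i y - M))
    (h0 : ∀ x, h 0 x < b * M) (hkey : ∀ x, key x < b * M) :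
    ∀ i < t, ∀ x, h (i + 1) x ≠ h i x → max (h (i + 1) x) (h i x) + i * M < b * M := by
  intro i
  induction i with
  | zero =>
    intro ht x _
    have h1 : h 1 x < b * M := by
      have := hstep 0 ht x
      rw [zero_add] at this
      rw [this]
      refine max_lt (hkey x) ?_
      rw [Finset.sup_lt_iff (lt_of_le_of_lt (Nat.zero_le _) (h0 x))]
      intro y _
      exact lt_of_le_of_lt (Nat.sub_le _ _) (h0 y)
    simpa using ⟨h1, h0 x⟩
  | succ i ih =>
    intro ht x hne
    have e1 := hstep (i + 1) ht x
    have e2 := hstep i (by omega) x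
    have hmul : (i + 1) * M = i * M + M := by ring
    -- Whether the value falls or rises, the larger of the two stems from a neighbor that is bigger
    -- by `M` and that changed one step earlier.
    rcases lt_or_gt_of_ne hne with hlt | hlt
    · have hlt' := hlt
      rw [e1, e2] at hlt'
      obtain ⟨y, -, hy1, hy2⟩ := exists_of_max_sup_tsub_lt hlt'
      have := ih (by omega) y (by omega)
      omega
    · have hlt' : h (i + 1) x < h (i + 1 + 1) x := hlt
      rw [e1, e2] at hlt'
      obtain ⟨y, -, hy1, hy2⟩ := exists_of_max_sup_tsub_lt hlt'
      have := ih (by omega) y (by omega)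
      omega

/-- A change at step `i ≥ b` would need a value below `b * M - i * M`. The starting values only have
to be bounded, so nothing has to be reset between phases. -/
theorem flood_stabilises {h : ℕ → α → ℕ} {b t : ℕ}
    (hstep : ∀ i < t, ∀ x, h (i + 1) x = max (key x) ((R x).sup fun y => h i y - M))
    (h0 : ∀ x, h 0 x < b * M) (hkey : ∀ x, key x < b * M) {i : ℕ} (hbi : b ≤ i) (hit : i ≤ t) :
    h i = h b := by
  induction i, hbi using Nat.le_induction with
  | base => rfl
  | succ i hbi ih =>
    rw [← ih (by omega)]
    funext x
    by_contra hne
    have := flood_change_lt hstep h0 hkey i (by omega) x hne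
    have : b * M ≤ i * M := Nat.mul_le_mul_right M hbi
    omega

theorem flood_isPotential {h : ℕ → α → ℕ} {b t : ℕ}
    (hstep : ∀ i < t, ∀ x, h (i + 1) x = max (key x) ((R x).sup fun y => h i y - M))
    (h0 : ∀ x, h 0 x < b * M) (hkey : ∀ x, key x < b * M) (hbt : b < t) :
    IsPotential M R key (h b) := by
  intro x
  rw [← hstep b hbt x, flood_stabilises hstep h0 hkey (Nat.le_succ b) hbt]

theorem exists_isPotential {b : ℕ} (hkey : ∀ x, key x < b * M) :
    ∃ f, IsPotential M R key f := by
  rcases isEmpty_or_nonempty α with hα | ⟨⟨x₀⟩⟩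
  · exact ⟨fun _ => 0, fun x => (hα.false x).elim⟩
  have hb : 0 < b * M := lt_of_le_of_lt (Nat.zero_le _) (hkey x₀)
  let h : ℕ → α → ℕ := fun i => Nat.rec (fun _ => 0)
    (fun _ v x => max (key x) ((R x).sup fun y => v y - M)) i
  exact ⟨h b, flood_isPotential (t := b + 1) (fun i _ x => rfl) (fun _ => hb) hkey (by omega)⟩

end Flood

theorem mul_add_mod_of_lt_right (a : ℕ) {b c : ℕ} (h : c < b) : (a * b + c) % b = c := by
  rw [Nat.mul_add_mod', Nat.mod_eq_of_lt h]

/-! ### Centers, rivals and the effect of a larger radius -/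

section Joining

variable {α : Type*}

/-- The members of `R x` whose potential has the same center (residue modulo `M`) as that of `x`. -/
def sameCenter (M : ℕ) (R : α → Finset α) (f : α → ℕ) (x : α) : Finset α :=
  (R x).filter fun y => f y % M = f x % M

/-- The largest potential that reaches `x` from a member of `R x` with another center. -/
def rivalKey (M : ℕ) (R : α → Finset α) (f : α → ℕ) (x : α) : ℕ :=
  ((R x).filter fun y => ¬ f y % M = f x % M).sup fun y => f y - M

/-- The potential of `x` exceeds every value reaching `x` from rival centers by at least `2 * M`. -/
def Joins {α : Type*} (M : ℕ) (R : α → Finset α) (key : α → ℕ) (x : α) : Prop :=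
  ∀ f g, IsPotential M R key f → IsPotential M (sameCenter M R f) (rivalKey M R f) g →
    g x + 2 * M ≤ f x

/-- The initial value of an active node of radius `ρ x` and identifier `ident x`. -/
noncomputable def shiftKey {α : Type*} (M : ℕ) (S : Set α) (ident ρ : α → ℕ) (x : α) : ℕ :=
  open Classical in if x ∈ S then ρ x * M + ident x else 0

theorem shiftKey_of_mem {M : ℕ} {S : Set α} {ident ρ : α → ℕ} {x : α} (hx : x ∈ S) :
    shiftKey M S ident ρ x = ρ x * M + ident x := by
  simp [shiftKey, hx]

theorem shiftKey_of_notMem {M : ℕ} {S : Set α} {ident ρ : α → ℕ} {x : α} (hx : x ∉ S) :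
    shiftKey M S ident ρ x = 0 := by
  simp [shiftKey, hx]

theorem shiftKey_lt {M : ℕ} {S : Set α} {ident ρ : α → ℕ} {B : ℕ} (hM : 0 < M)
    (hid : ∀ x, ident x < M) (hρ : ∀ x, ρ x ≤ B) (x : α) :
    shiftKey M S ident ρ x < (B + 1) * M := by
  have h1 : ρ x * M ≤ B * M := Nat.mul_le_mul_right M (hρ x)
  have h2 : (B + 1) * M = B * M + M := by ring
  have h3 := hid x
  unfold shiftKey
  split_ifs <;> omega

variable {M : ℕ} {S : Set α} {R : α → Finset α} {ident ρ f : α → ℕ}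

theorem IsPotential.eq_zero_of_notMem {key : α → ℕ} (hR : ∀ x ∉ S, R x = ∅)
    (hkey : ∀ x ∉ S, key x = 0) (h : IsPotential M R key f) {x : α} (hx : x ∉ S) : f x = 0 := by
  rw [h x, hR x hx, hkey x hx]
  simp

theorem IsPotential.mem_of_pos {key : α → ℕ} (hR : ∀ x ∉ S, R x = ∅)
    (hkey : ∀ x ∉ S, key x = 0) (h : IsPotential M R key f) {x : α} (hx : 0 < f x) : x ∈ S := by
  by_contra hxS
  rw [h.eq_zero_of_notMem hR hkey hxS] at hx
  exact hx.false

theorem IsPotential.exists_center [Finite α] (hM : 0 < M) (hid : ∀ x, ident x < M)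
    (hR : ∀ x ∉ S, R x = ∅) (h : IsPotential M R (shiftKey M S ident ρ) f) {x : α}
    (hx : x ∈ S) : ∃ v ∈ S, ident v = f x % M := by
  revert hx
  refine h.induction hM (P := fun x => x ∈ S → ∃ v ∈ S, ident v = f x % M) ?_ ?_ x
  · intro x hx hxS
    refine ⟨x, hxS, ?_⟩
    rw [hx, shiftKey_of_mem hxS, mul_add_mod_of_lt_right _ (hid x)]
  · intro x y _ hxy ih _
    obtain ⟨v, hv, hv'⟩ := ih (h.mem_of_pos hR (fun _ => shiftKey_of_notMem) (by omega))
    exact ⟨v, hv, by rw [hv', hxy, Nat.add_mod_right]⟩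

/-- Increasing the radius of the center of `u` by two makes `u` join, with the same center. -/
theorem joins_of_bump [Finite α] [DecidableEq α] (hM : 0 < M) (hinj : Function.Injective ident)
    (hid : ∀ x, ident x < M) (hR : ∀ x ∉ S, R x = ∅)
    (h : IsPotential M R (shiftKey M S ident ρ) f) {u v : α} (hu : u ∈ S)
    (hvu : ident v = f u % M) {f' : α → ℕ}
    (h' : IsPotential M R (shiftKey M S ident (Function.update ρ v (ρ v + 2))) f') :
    f' u % M = f u % M ∧ ∀ g', IsPotential M (sameCenter M R f') (rivalKey M R f') g' →
      g' u + 2 * M ≤ f' u := by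
  have hz : ∀ {ρ : α → ℕ}, ∀ x ∉ S, shiftKey M S ident ρ x = 0 := fun _ => shiftKey_of_notMem
  -- Where the old center is `v`, the extra radius travels along the old path.
  have hup : ∀ x, x ∈ S → f x % M = ident v → f x + 2 * M ≤ f' x := by
    refine h.induction hM ?_ ?_
    · intro x hx hxS hxv
      have hxv' : x = v := by
        apply hinj
        rw [← hxv, hx, shiftKey_of_mem hxS, mul_add_mod_of_lt_right _ (hid x)]
      have h1 := h'.key_le x
      rw [shiftKey_of_mem hxS] at h1 hx
      subst hxv'
      rw [Function.update_self] at h1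
      have : (ρ x + 2) * M = ρ x * M + 2 * M := by ring
      omega
    · intro x y hy hxy ih _ hxv
      have h1 := ih (h.mem_of_pos hR hz (by omega)) (by rw [hxy, Nat.add_mod_right, hxv])
      have h2 := h'.le_add hy
      omega
  -- Values whose new center is not `v` come from unchanged keys, so they were already present
  -- before.
  have hdown : ∀ x, f' x % M ≠ ident v → f' x ≤ f x := by
    refine h'.induction hM ?_ ?_
    · intro x hx hxv
      by_cases hxS : x ∈ S
      · have hne : x ≠ v := by
          rintro rfl
          rw [hx, shiftKey_of_mem hxS, mul_add_mod_of_lt_right _ (hid x)] at hxv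
          exact hxv rfl
        have h1 := h.key_le x
        rw [shiftKey_of_mem hxS] at h1 hx
        rw [Function.update_of_ne hne] at hx
        omega
      · rw [h'.eq_zero_of_notMem hR hz hxS]
        exact Nat.zero_le _
    · intro x y hy hxy ih hxv
      have h1 := ih (by rwa [hxy, Nat.add_mod_right])
      have h2 := h.le_add hy
      omega
  have hu1 := hup u hu hvu.symm
  have hcu : f' u % M = ident v := by
    by_contra hne
    have := hdown u hne
    omega
  refine ⟨hcu.trans hvu, fun g' hg' => ?_⟩
  -- Rival values are inherited from centers other than `v`, so they are bounded by the old
  -- potential, which lies `2 * M` below the new one.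
  have hg : ∀ x, f' x % M = ident v → g' x ≤ f x := by
    refine hg'.induction hM ?_ ?_
    · intro x hx hxv
      rw [hx]
      refine Finset.sup_le fun y hy => ?_
      rw [Finset.mem_filter] at hy
      have h1 := hdown y (by rw [← hxv]; exact hy.2)
      have h2 := h.le_add hy.1
      omega
    · intro x y hy hxy ih hxv
      rw [sameCenter, Finset.mem_filter] at hy
      have h1 := ih (by rw [hy.2, hxv])
      have h2 := h.le_add hy.1
      omega
  have := hg u hcu
  omega

end Joining

/-! ### Transport along an embedding of the nodes -/

section Transfer

variable {α β : Type*} {M : ℕ} {R : α → Finset α} {R' : β → Finset β} {key f : α → ℕ}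
  {key' : β → ℕ} {φ : α ↪ β}

theorem IsPotential.extend (hR : ∀ x, R' (φ x) = (R x).map φ)
    (hR' : ∀ y ∉ Set.range φ, R' y = ∅) (hkey : ∀ x, key' (φ x) = key x)
    (hkey' : ∀ y ∉ Set.range φ, key' y = 0) (h : IsPotential M R key f) :
    IsPotential M R' key' (Function.extend φ f 0) := by
  intro y
  by_cases hy : y ∈ Set.range φ
  · obtain ⟨x, rfl⟩ := hy
    rw [φ.injective.extend_apply, hR, hkey, Finset.sup_map, h x]
    congr 2
    funext z
    simp [φ.injective.extend_apply, Function.comp]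
  · rw [Function.extend_apply' _ _ _ (by simpa using hy), hR' y hy, hkey' y hy]
    simp

/-- Outside the range there are no neighbors and all keys vanish, so potentials extend by zero. This
carries a statement about networks on `Fin (2 ^ m)` over to an actual network, embedded by its
identifiers. -/
theorem Joins.of_embedding (hR : ∀ x, R' (φ x) = (R x).map φ)
    (hR' : ∀ y ∉ Set.range φ, R' y = ∅) (hkey : ∀ x, key' (φ x) = key x)
    (hkey' : ∀ y ∉ Set.range φ, key' y = 0) {x : α} (h : Joins M R' key' (φ x)) :
    Joins M R key x := by
  intro f g hf hg
  have := h (Function.extend φ f 0) (Function.extend φ g 0) (hf.extend hR hR' hkey hkey')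
    (hg.extend ?_ ?_ ?_ ?_)
  · simpa [φ.injective.extend_apply] using this
  · intro x
    simp only [sameCenter, hR, Finset.filter_map, φ.injective.extend_apply]
    congr 1
    ext z
    simp [φ.injective.extend_apply]
  · intro y hy
    simp [sameCenter, hR' y hy]
  · intro x
    simp only [rivalKey, hR, Finset.filter_map, φ.injective.extend_apply, Finset.sup_map]
    congr 1
    · ext z
      simp [φ.injective.extend_apply]
    · funext z
      simp [φ.injective.extend_apply, Function.comp]
  · intro y hy
    simp [rivalKey, hR' y hy]

end Transfer

/-! ### Truncated geometric radii and the probability of joining -/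

section Weights

/-- The truncated geometric distribution on `{0, …, B}`. -/
noncomputable def geomWeight (B : ℕ) (k : Fin (B + 1)) : ℝ :=
  (1 / 2) ^ (k : ℕ) / ∑ j : Fin (B + 1), (1 / 2 : ℝ) ^ (j : ℕ)

theorem one_le_sum_half_pow (B : ℕ) : 1 ≤ ∑ j : Fin (B + 1), (1 / 2 : ℝ) ^ (j : ℕ) := by
  have := Finset.single_le_sum (f := fun j : Fin (B + 1) => (1 / 2 : ℝ) ^ (j : ℕ))
    (fun j _ => by positivity) (Finset.mem_univ 0)
  simpa using this

theorem geomWeight_nonneg (B : ℕ) (k : Fin (B + 1)) : 0 ≤ geomWeight B k := by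
  have := one_le_sum_half_pow B
  unfold geomWeight
  positivity

theorem sum_geomWeight (B : ℕ) : ∑ k, geomWeight B k = 1 := by
  have := one_le_sum_half_pow B
  simp only [geomWeight]
  rw [← Finset.sum_div]
  exact div_self (by positivity)

theorem geomWeight_le (B : ℕ) (k : Fin (B + 1)) : geomWeight B k ≤ (1 / 2) ^ (k : ℕ) :=
  div_le_self (by positivity) (one_le_sum_half_pow B)

theorem geomWeight_add_two {B : ℕ} {k l : Fin (B + 1)} (h : (l : ℕ) = k + 2) :
    geomWeight B l = 1 / 4 * geomWeight B k := by
  simp only [geomWeight, h, pow_add]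
  ring

theorem sum_geomWeight_top_le {B : ℕ} (hB : 1 ≤ B) :
    ∑ k ∈ Finset.univ.filter (fun k : Fin (B + 1) => B < (k : ℕ) + 2), geomWeight B k ≤
      2 * (1 / 2) ^ (B - 1) := by
  have hcard : (Finset.univ.filter fun k : Fin (B + 1) => B < (k : ℕ) + 2).card ≤ 2 := by
    rw [← Finset.card_map Fin.valEmbedding]
    refine (Finset.card_le_card (t := Finset.Icc (B - 1) B) ?_).trans (by simp; omega)
    intro k hk
    simp only [Finset.mem_map, Finset.mem_filter, Fin.valEmbedding_apply] at hk
    obtain ⟨j, hj, rfl⟩ := hk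
    rw [Finset.mem_Icc]
    omega
  calc _ ≤ (Finset.univ.filter fun k : Fin (B + 1) => B < (k : ℕ) + 2).card •
        ((1 / 2 : ℝ) ^ (B - 1)) := by
        refine Finset.sum_le_card_nsmul _ _ _ fun k hk => ?_
        rw [Finset.mem_filter] at hk
        exact (geomWeight_le B k).trans
          (pow_le_pow_of_le_one (by norm_num) (by norm_num) (by omega))
    _ ≤ 2 * (1 / 2) ^ (B - 1) := by
        rw [nsmul_eq_mul]
        gcongr
        exact_mod_cast hcard

variable {α κ : Type*} [Fintype α] [DecidableEq α] [Fintype κ] {p : κ → ℝ}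

theorem sum_prod_eq_one (hp : ∑ k, p k = 1) : ∑ ω : α → κ, ∏ x, p (ω x) = 1 := by
  have := Finset.sum_prod_piFinset (ι := α) Finset.univ (fun _ => p)
  simp only [hp, Finset.prod_const_one] at this
  rw [← this]
  simp

theorem sum_prod_marginal [DecidableEq κ] (hp : ∑ k, p k = 1) (x : α)
    (Q : Finset κ) : ∑ ω : α → κ with ω x ∈ Q, ∏ y, p (ω y) = ∑ k ∈ Q, p k := by
  have h1 : (Finset.univ.filter fun ω : α → κ => ω x ∈ Q) =
      Fintype.piFinset fun y => if y = x then Q else Finset.univ := by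
    ext ω
    simp only [Finset.mem_filter, Finset.mem_univ, true_and, Fintype.mem_piFinset]
    constructor
    · intro h y
      split_ifs with hy
      · rwa [hy]
      · exact Finset.mem_univ _
    · intro h
      simpa using h x
  rw [h1, ← Finset.prod_univ_sum (fun y => if y = x then Q else Finset.univ) (fun _ k => p k),
    Finset.prod_eq_single x]
  · simp
  · intro y _ hy
    simp [hy, hp]
  · simp

/-- Union bound over `S`: one radius takes one of the two top values, which cannot be raised by 2,
with probability at most `2 * (1 / 2) ^ (B - 1)`. -/
theorem half_le_sum_small_radii {B : ℕ} (hB : 1 ≤ B) (S : Finset α)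
    (hS : (S.card : ℝ) * (2 * (1 / 2) ^ (B - 1)) ≤ 1 / 2) :
    1 / 2 ≤ ∑ ω : α → Fin (B + 1) with ∀ x ∈ S, (ω x : ℕ) + 2 ≤ B, ∏ x, geomWeight B (ω x) := by
  have htot : ∑ ω : α → Fin (B + 1), ∏ x, geomWeight B (ω x) = 1 :=
    sum_prod_eq_one (sum_geomWeight B)
  rw [← Finset.sum_filter_add_sum_filter_not Finset.univ
    (fun ω : α → Fin (B + 1) => ∀ x ∈ S, (ω x : ℕ) + 2 ≤ B)] at htot
  have hW : ∀ ω : α → Fin (B + 1), 0 ≤ ∏ x, geomWeight B (ω x) :=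
    fun ω => Finset.prod_nonneg fun x _ => geomWeight_nonneg B _
  have hbad : ∑ ω : α → Fin (B + 1) with ¬ ∀ x ∈ S, (ω x : ℕ) + 2 ≤ B,
      ∏ x, geomWeight B (ω x) ≤ 1 / 2 := by
    calc _ ≤ ∑ ω : α → Fin (B + 1), ∑ x ∈ S,
          if ω x ∈ Finset.univ.filter (fun k : Fin (B + 1) => B < (k : ℕ) + 2) then
            ∏ x, geomWeight B (ω x) else 0 := by
          rw [Finset.sum_filter]
          refine Finset.sum_le_sum fun ω _ => ?_
          have hnn : ∀ x ∈ S,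
              0 ≤ if ω x ∈ Finset.univ.filter (fun k : Fin (B + 1) => B < (k : ℕ) + 2) then
                ∏ x, geomWeight B (ω x) else 0 := fun x _ => by
            split_ifs
            exacts [hW ω, le_rfl]
          split_ifs with h
          · exact Finset.sum_nonneg hnn
          · push Not at h
            obtain ⟨x, hx, h⟩ := h
            refine le_of_eq_of_le ?_ (Finset.single_le_sum hnn hx)
            simp [h]
      _ = ∑ x ∈ S, ∑ ω : α → Fin (B + 1) with
          ω x ∈ Finset.univ.filter fun k : Fin (B + 1) => B < (k : ℕ) + 2,
            ∏ x, geomWeight B (ω x) := by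
          rw [Finset.sum_comm]
          exact Finset.sum_congr rfl fun x _ => (Finset.sum_filter _ _).symm
      _ ≤ ∑ x ∈ S, 2 * (1 / 2 : ℝ) ^ (B - 1) := by
          refine Finset.sum_le_sum fun x _ => ?_
          rw [sum_prod_marginal (sum_geomWeight B)]
          exact sum_geomWeight_top_le hB
      _ ≤ 1 / 2 := by simpa using hS
  linarith

/-- For truncated geometric radii, every active node joins with probability at least `1 / 8`. -/
theorem eighth_le_sum_joins {M B : ℕ} (hM : 0 < M) (hB : 1 ≤ B) (S : Finset α)
    (hS : (S.card : ℝ) * (2 * (1 / 2) ^ (B - 1)) ≤ 1 / 2) {R : α → Finset α} {ident : α → ℕ}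
    (hinj : Function.Injective ident) (hid : ∀ x, ident x < M) (hR : ∀ x ∉ S, R x = ∅)
    {u : α} (hu : u ∈ S)
    [DecidablePred fun ω : α → Fin (B + 1) => Joins M R (shiftKey M S ident fun x => ω x) u] :
    1 / 8 ≤ ∑ ω : α → Fin (B + 1) with Joins M R (shiftKey M S ident fun x => ω x) u,
      ∏ x, geomWeight B (ω x) := by
  have hR' : ∀ x ∉ (S : Set α), R x = ∅ := by simpa using hR
  have hu' : u ∈ (S : Set α) := hu
  have hf : ∀ ω : α → Fin (B + 1), ∃ f, IsPotential M R (shiftKey M S ident fun x => ω x) f :=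
    fun ω => exists_isPotential (b := B + 1)
      (shiftKey_lt hM hid fun x => Nat.lt_succ_iff.mp (ω x).2)
  choose f hf using hf
  choose v hvS hv using fun ω => (hf ω).exists_center hM hid hR' hu'
  set A : Finset (α → Fin (B + 1)) :=
    Finset.univ.filter fun ω => ∀ x ∈ S, (ω x : ℕ) + 2 ≤ B with hA
  have hAv : ∀ ω ∈ A, (ω (v ω) : ℕ) + 2 < B + 1 := by
    intro ω hω
    rw [hA, Finset.mem_filter] at hω
    exact Nat.lt_succ_of_le (hω.2 _ (hvS ω))
  -- `Fin.ofNat` reduces modulo `B + 1`; on `A` the raised radius is still at most `B`, so nothing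
  -- wraps around.
  let bump : (α → Fin (B + 1)) → (α → Fin (B + 1)) := fun ω =>
    Function.update ω (v ω) (Fin.ofNat (B + 1) (ω (v ω) + 2))
  have hval : ∀ ω ∈ A, ((Fin.ofNat (B + 1) (ω (v ω) + 2) : Fin (B + 1)) : ℕ) = ω (v ω) + 2 :=
    fun ω hω => Nat.mod_eq_of_lt (hAv ω hω)
  have hbump : ∀ ω ∈ A, (fun x => (bump ω x : ℕ)) =
      Function.update (fun x => (ω x : ℕ)) (v ω) (ω (v ω) + 2) := by
    intro ω hω
    funext x
    by_cases hx : x = v ω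
    · subst hx
      simp only [bump, Function.update_self, hval ω hω]
    · simp only [bump, Function.update_of_ne hx]
  have key : ∀ ω ∈ A, ∀ f', IsPotential M R (shiftKey M S ident fun x => bump ω x) f' →
      f' u % M = f ω u % M ∧ ∀ g', IsPotential M (sameCenter M R f') (rivalKey M R f') g' →
        g' u + 2 * M ≤ f' u := by
    intro ω hω f' hf'
    rw [hbump ω hω] at hf'
    exact joins_of_bump hM hinj hid hR' (hf ω) hu' (hv ω) hf'
  -- The center of `u` can be read off after the bump, and it tells which radius has to be lowered.
  have hinjOn : Set.InjOn bump A := by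
    intro ω hω ω' hω' heq
    have h1 := (key ω hω (f (bump ω)) (hf _)).1
    have h2 := (key ω' hω' (f (bump ω')) (hf _)).1
    have hvv : v ω = v ω' := hinj (by rw [hv, hv, ← h1, ← h2, heq])
    have e1 := hbump ω hω
    have e2 := hbump ω' hω'
    rw [heq, e2] at e1
    funext x
    apply Fin.ext
    have hx := congrFun e1 x
    rw [hvv] at hx
    by_cases hxv : x = v ω'
    · subst hxv
      simp only [Function.update_self] at hx
      omega
    · simp only [Function.update_of_ne hxv] at hx
      exact hx.symm
  have hweight : ∀ ω ∈ A, ∏ x, geomWeight B (bump ω x) = 1 / 4 * ∏ x, geomWeight B (ω x) := by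
    intro ω hω
    rw [← Finset.mul_prod_erase _ _ (Finset.mem_univ (v ω)),
      ← Finset.mul_prod_erase (a := v ω) _ (fun x => geomWeight B (ω x)) (Finset.mem_univ _),
      ← mul_assoc]
    congr 1
    · simp only [bump, Function.update_self]
      exact geomWeight_add_two (hval ω hω)
    · refine Finset.prod_congr rfl fun x hx => ?_
      simp only [bump, Function.update_of_ne (Finset.ne_of_mem_erase hx)]
  calc (1 / 8 : ℝ) = 1 / 4 * (1 / 2) := by norm_num
    _ ≤ 1 / 4 * ∑ ω ∈ A, ∏ x, geomWeight B (ω x) := by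
        gcongr
        exact half_le_sum_small_radii hB S hS
    _ = ∑ ω ∈ A.image bump, ∏ x, geomWeight B (ω x) := by
        rw [Finset.sum_image hinjOn, Finset.mul_sum]
        exact Finset.sum_congr rfl fun ω hω => (hweight ω hω).symm
    _ ≤ _ := by
        refine Finset.sum_le_sum_of_subset_of_nonneg ?_
          fun ω _ _ => Finset.prod_nonneg fun x _ => geomWeight_nonneg B _
        intro η hη
        obtain ⟨ω, hω, rfl⟩ := Finset.mem_image.mp hη
        rw [Finset.mem_filter]
        exact ⟨Finset.mem_univ _, fun f' g' hf' hg' => (key ω hω f' hf').2 g' hg'⟩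

end Weights

/-! ### Derandomization: a fixed table of radii -/

section Sampling

/-- If every event `good x` has probability at least `1 / 8` and there are few events, then there is
a small sample in which every event has frequency at least `1 / 16`. -/
theorem exists_sample {Ω X ι : Type*} [Fintype Ω] [Fintype X] [Fintype ι] {W : Ω → ℝ}
    (hW : ∀ ω, 0 ≤ W ω) (hW1 : ∑ ω, W ω = 1) (good : X → Ω → Prop)
    [∀ x, DecidablePred (good x)] (hgood : ∀ x, 1 / 8 ≤ ∑ ω with good x ω, W ω) {k q : ℕ}
    (hX : Fintype.card X ≤ 2 ^ k) (hι : Fintype.card ι = 16 * q) (hkq : 3 * k < q) :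
    ∃ σ : ι → Ω, ∀ x, q ≤ (Finset.univ.filter fun j => good x (σ j)).card := by
  classical
  by_contra! hcon
  -- If `p ≥ 1 / 8` is the probability of `good x`, the expectation of the factor is `1 - p / 2`.
  -- The product over the sample is the exponential moment of the Chernoff bound.
  have hmgf : ∀ x, ∑ ω, W ω * (if good x ω then 1 / 2 else 1) ≤ 15 / 16 := by
    intro x
    have h1 : ∀ ω, W ω * (if good x ω then (1 / 2 : ℝ) else 1) =
        W ω - 1 / 2 * (if good x ω then W ω else 0) := by
      intro ω
      split_ifs <;> ring
    simp only [h1]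
    rw [Finset.sum_sub_distrib, hW1, ← Finset.mul_sum, ← Finset.sum_filter]
    linarith [hgood x]
  have hpow : ∀ x, ∑ σ : ι → Ω, ∏ j, (W (σ j) * (if good x (σ j) then 1 / 2 else 1)) ≤
      (15 / 16) ^ (16 * q) := by
    intro x
    have h1 := Finset.sum_prod_piFinset (ι := ι) Finset.univ
      (fun _ ω => W ω * (if good x ω then (1 / 2 : ℝ) else 1))
    rw [Fintype.piFinset_univ] at h1
    rw [h1, Finset.prod_const, Finset.card_univ, hι]
    refine pow_le_pow_left₀ (Finset.sum_nonneg fun ω _ => ?_) (hmgf x) _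
    have := hW ω
    positivity
  have hσ : ∀ σ : ι → Ω, ∏ j, W (σ j) ≤
      2 ^ q * ∑ x, ∏ j, (W (σ j) * (if good x (σ j) then 1 / 2 else 1)) := by
    intro σ
    obtain ⟨x, hx⟩ := hcon σ
    have hnn : ∀ x, 0 ≤ ∏ j, (W (σ j) * (if good x (σ j) then (1 / 2 : ℝ) else 1)) :=
      fun x => Finset.prod_nonneg fun j _ => by
        have := hW (σ j)
        positivity
    have h2 : ∏ j, (W (σ j) * (if good x (σ j) then (1 / 2 : ℝ) else 1)) =
        (∏ j, W (σ j)) * (1 / 2) ^ (Finset.univ.filter fun j => good x (σ j)).card := by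
      rw [Finset.prod_mul_distrib, ← Finset.prod_filter, Finset.prod_const]
    have h3 : (1 / 2 : ℝ) ^ q ≤ (1 / 2) ^ (Finset.univ.filter fun j => good x (σ j)).card :=
      pow_le_pow_of_le_one (by norm_num) (by norm_num) hx.le
    have h4 : (0 : ℝ) ≤ ∏ j, W (σ j) := Finset.prod_nonneg fun j _ => hW _
    have h5 : (2 : ℝ) ^ q * (1 / 2) ^ q = 1 := by
      rw [← mul_pow]
      norm_num
    calc ∏ j, W (σ j) = 2 ^ q * ((∏ j, W (σ j)) * (1 / 2) ^ q) := by
          rw [mul_left_comm, h5, mul_one]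
      _ ≤ 2 ^ q * ∏ j, (W (σ j) * (if good x (σ j) then (1 / 2 : ℝ) else 1)) := by
          rw [h2]
          gcongr
      _ ≤ _ := by
          gcongr
          exact Finset.single_le_sum (f := fun x => ∏ j, (W (σ j) *
            (if good x (σ j) then (1 / 2 : ℝ) else 1))) (fun x _ => hnn x) (Finset.mem_univ x)
  have htot : (1 : ℝ) ≤ 2 ^ k * (3 / 4) ^ q := by
    calc (1 : ℝ) = ∑ σ : ι → Ω, ∏ j, W (σ j) := (sum_prod_eq_one hW1).symm
      _ ≤ ∑ σ : ι → Ω, 2 ^ q * ∑ x, ∏ j, (W (σ j) * (if good x (σ j) then 1 / 2 else 1)) :=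
          Finset.sum_le_sum fun σ _ => hσ σ
      _ = 2 ^ q * ∑ x, ∑ σ : ι → Ω, ∏ j, (W (σ j) * (if good x (σ j) then 1 / 2 else 1)) := by
          rw [← Finset.mul_sum, Finset.sum_comm]
      _ ≤ 2 ^ q * ∑ _x : X, (15 / 16 : ℝ) ^ (16 * q) := by
          gcongr
          exact hpow _
      _ = Fintype.card X * (2 * (15 / 16) ^ 16) ^ q := by
          rw [Finset.sum_const, Finset.card_univ, nsmul_eq_mul, mul_pow, ← pow_mul]
          ring
      _ ≤ 2 ^ k * (3 / 4) ^ q := by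
          gcongr
          · exact_mod_cast hX
          · norm_num
  -- Here `2 * (3 / 4) ^ 3 < 1`, so `q > 3 * k` beats the `2 ^ k` events.
  have hlt : (2 : ℝ) ^ k * (3 / 4) ^ q < 1 := by
    calc (2 : ℝ) ^ k * (3 / 4) ^ q ≤ 2 ^ k * (3 / 4) ^ (3 * k + 1) := by
          gcongr 2 ^ k * ?_
          exact pow_le_pow_of_le_one (by norm_num) (by norm_num) hkq
      _ = (2 * (3 / 4) ^ 3) ^ k * (3 / 4) := by rw [pow_succ, mul_pow, ← pow_mul]; ring
      _ ≤ 1 * (3 / 4) := by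
          gcongr
          exact pow_le_one₀ (by norm_num) (by norm_num)
      _ < 1 := by norm_num
  linarith

/-- A table of radii, indexed by seeds of `2 * m + 8` bits, that for every network with identifiers
below `2 ^ m` and every active node makes the node join for a `1 / 16` fraction of the seeds. -/
theorem exists_radiusTable (m B : ℕ) (hB : 1 ≤ B) :
    ∃ σ : (Fin (2 * m + 8) → Bool) → Fin (2 ^ m) → Fin (B + 1),
      ∀ (R : Fin (2 ^ m) → Finset (Fin (2 ^ m))) (S : Finset (Fin (2 ^ m))) (u : Fin (2 ^ m)),
        (S.card : ℝ) * (2 * (1 / 2) ^ (B - 1)) ≤ 1 / 2 → (∀ x ∉ S, R x = ∅) → u ∈ S →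
          2 ^ (2 * m + 4) ≤ Nat.card {j // Joins (2 ^ m) R
            (shiftKey (2 ^ m) S (fun x => x) fun x => σ j x) u} := by
  classical
  let X := {x : (Fin (2 ^ m) → Finset (Fin (2 ^ m))) × Finset (Fin (2 ^ m)) × Fin (2 ^ m) //
    (x.2.1.card : ℝ) * (2 * (1 / 2) ^ (B - 1)) ≤ 1 / 2 ∧ (∀ y ∉ x.2.1, x.1 y = ∅) ∧
      x.2.2 ∈ x.2.1}
  -- The exponent counts the bits of a configuration: a neighborhood for each identifier, the active
  -- set, and the node.
  have hX : Fintype.card X ≤ 2 ^ (2 ^ m * 2 ^ m + 2 ^ m + m) := by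
    refine (Fintype.card_subtype_le _).trans (le_of_eq ?_)
    simp only [Fintype.card_prod, Fintype.card_fun, Fintype.card_finset, Fintype.card_fin]
    rw [pow_add, pow_add, ← pow_mul, mul_assoc]
  have hkq : 3 * (2 ^ m * 2 ^ m + 2 ^ m + m) < 2 ^ (2 * m + 4) := by
    have h1 : m < 2 ^ m := Nat.lt_two_pow_self
    have h2 : 2 ^ (2 * m + 4) = 16 * (2 ^ m * 2 ^ m) := by ring
    rw [h2]
    nlinarith
  obtain ⟨σ, hσ⟩ := exists_sample (ι := Fin (2 * m + 8) → Bool) (X := X)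
    (W := fun ω : Fin (2 ^ m) → Fin (B + 1) => ∏ x, geomWeight B (ω x))
    (fun ω => Finset.prod_nonneg fun x _ => geomWeight_nonneg B _)
    (sum_prod_eq_one (sum_geomWeight B))
    (fun x ω => Joins (2 ^ m) x.1.1 (shiftKey (2 ^ m) x.1.2.1 (fun x => x) fun x => ω x) x.1.2.2)
    (fun x => eighth_le_sum_joins (by positivity) hB x.1.2.1 x.2.1 Fin.val_injective
      (fun x => x.2) x.2.2.1 x.2.2.2) hX (q := 2 ^ (2 * m + 4)) (by simp; ring) hkq
  refine ⟨σ, fun R S u h1 h2 h3 => ?_⟩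
  have := hσ ⟨(R, S, u), h1, h2, h3⟩
  rwa [Nat.card_eq_fintype_card, Fintype.card_subtype]

end Sampling

/-! ### Expected decay of the leftover nodes -/

section Phases

variable {α ι : Type*}

/-- The members that are left over after `k` phases with seeds `J 0, J 1, …`. -/
def leftover (step : ι → Finset α → Finset α) (S : Finset α) (J : ℕ → ι) : ℕ → Finset α
  | 0 => S
  | k + 1 => step (J k) (leftover step S J k)

theorem leftover_congr {step : ι → Finset α → Finset α} {S : Finset α} {J J' : ℕ → ι} {k : ℕ}
    (h : ∀ i < k, J i = J' i) : leftover step S J k = leftover step S J' k := by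
  induction k with
  | zero => rfl
  | succ k ih =>
    simp only [leftover]
    rw [h k (by omega), ih fun i hi => h i (by omega)]

theorem leftover_subset {step : ι → Finset α → Finset α} (hstep : ∀ j S, step j S ⊆ S)
    {S : Finset α} {J : ℕ → ι} (k : ℕ) : leftover step S J k ⊆ S := by
  induction k with
  | zero => exact subset_rfl
  | succ k ih => exact (hstep _ _).trans ih

/-- The extension of finitely many seeds to a sequence. -/
def extendSeeds (j₀ : ι) {T : ℕ} (J : Fin T → ι) (k : ℕ) : ι :=
  if h : k < T then J ⟨k, h⟩ else j₀

/-- The leftover set before a phase depends on earlier seeds only, so the bound for a fixed set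
applies conditionally; summing over the seeds replaces expectations. -/
theorem sum_card_leftover_le [Fintype ι] {step : ι → Finset α → Finset α}
    {q : ℝ} (hq : 0 ≤ q) (S₀ : Finset α) (hsub : ∀ j S, step j S ⊆ S)
    (hstep : ∀ S ⊆ S₀, ∀ u ∈ S, (Nat.card {j // u ∈ step j S} : ℝ) ≤ q) (j₀ : ι) (T : ℕ) :
    ∑ J : Fin T → ι, ((leftover step S₀ (extendSeeds j₀ J) T).card : ℝ) ≤
      q ^ T * S₀.card := by
  classical
  have hone : ∀ S ⊆ S₀, ∑ j, ((step j S).card : ℝ) ≤ q * S.card := by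
    intro S hS
    calc ∑ j, ((step j S).card : ℝ) = ∑ j, ∑ u ∈ S, if u ∈ step j S then (1 : ℝ) else 0 := by
          refine Finset.sum_congr rfl fun j _ => ?_
          rw [Finset.sum_ite_mem, Finset.inter_eq_right.mpr (hsub j S)]
          simp
      _ = ∑ u ∈ S, (Nat.card {j // u ∈ step j S} : ℝ) := by
          rw [Finset.sum_comm]
          refine Finset.sum_congr rfl fun u _ => ?_
          rw [Nat.card_eq_fintype_card, Fintype.card_subtype]
          simp
      _ ≤ ∑ u ∈ S, q := Finset.sum_le_sum fun u hu => hstep S hS u hu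
      _ = q * S.card := by simp [mul_comm]
  induction T with
  | zero => simp [leftover]
  | succ T ih =>
    -- Split off the last seed, which is the one used in phase `T`.
    rw [← (Fin.snocEquiv fun _ : Fin (T + 1) => ι).sum_comp, Fintype.sum_prod_type_right]
    have hrun : ∀ (J : Fin T → ι) (j : ι),
        leftover step S₀ (extendSeeds j₀ ((Fin.snocEquiv fun _ : Fin (T + 1) => ι) (j, J))) (T + 1)
          = step j (leftover step S₀ (extendSeeds j₀ J) T) := by
      intro J j
      simp only [leftover]
      congr 1
      · simp only [extendSeeds, Nat.lt_succ_self, dite_true]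
        exact Fin.snoc_last (α := fun _ => ι) j J
      · refine leftover_congr fun i hi => ?_
        simp only [extendSeeds, hi, hi.trans (Nat.lt_succ_self T), dite_true]
        exact Fin.snoc_castSucc (α := fun _ => ι) j J ⟨i, hi⟩
    simp only [hrun]
    calc _ ≤ ∑ J : Fin T → ι, q * ((leftover step S₀ (extendSeeds j₀ J) T).card : ℝ) :=
          Finset.sum_le_sum fun J _ => hone _ (leftover_subset hsub T)
      _ ≤ q * (q ^ T * S₀.card) := by
          rw [← Finset.mul_sum]
          gcongr
      _ = q ^ (T + 1) * S₀.card := by ring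

end Phases

/-! ### Trees made of parent edges -/

section ParentTree

/-- A graph whose edges join the elements to their parents is a tree rooted at the only element
without a parent. -/
theorem isTree_of_parent {W : Type*} [Finite W] {T : SimpleGraph W} {par : W → W → Prop}
    {ht : W → ℕ} {B : ℕ} {r : W} (hT : ∀ x y, T.Adj x y ↔ par x y ∨ par y x)
    (hht : ∀ x y, par x y → ht y = ht x + 1) (hfun : ∀ x y z, par x y → par x z → y = z)
    (hroot : ∀ x, x ≠ r → ∃ y, par x y) (hB : ∀ x, ht x ≤ B) :
    T.IsTree ∧ ∀ x y, T.dist x y ≤ 2 * B := by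
  -- Heights increase towards the root and are at most `B`, so following parents ends there.
  have hwalk : ∀ k x, B - ht x ≤ k → ∃ p : T.Walk x r, p.length + ht x = ht r := by
    intro k
    induction k with
    | zero =>
      intro x hx
      by_cases hxr : x = r
      · subst hxr
        exact ⟨.nil, by simp⟩
      · obtain ⟨y, hy⟩ := hroot x hxr
        have := hht x y hy
        have := hB y
        omega
    | succ k ih =>
      intro x hx
      by_cases hxr : x = r
      · subst hxr
        exact ⟨.nil, by simp⟩
      · obtain ⟨y, hy⟩ := hroot x hxr
        have h1 := hht x y hy
        have h2 := hB y
        obtain ⟨p, hp⟩ := ih y (by omega)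
        refine ⟨.cons ((hT x y).mpr (Or.inl hy)) p, ?_⟩
        rw [SimpleGraph.Walk.length_cons]
        omega
  choose p hp using fun x => hwalk _ x le_rfl
  have hconn : T.Connected := by
    have : Nonempty W := ⟨r⟩
    exact ⟨fun x y => ⟨(p x).append (p y).reverse⟩⟩
  refine ⟨?_, fun x y => ?_⟩
  · rw [SimpleGraph.isTree_iff_connected_and_card]
    refine ⟨hconn, le_antisymm ?_ hconn.card_vert_le_card_edgeSet_add_one⟩
    have hr : ∀ y, ¬ par r y := by
      intro y hy
      have h1 := hht r y hy
      have h2 := hp y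
      omega
    choose q hq using fun x : {x // x ≠ r} => hroot x x.2
    -- Every edge joins some non-root element to its parent, so there are at most `card W - 1`
    -- edges; a connected graph with so few edges is a tree.
    let F : {x // x ≠ r} → T.edgeSet := fun x =>
      ⟨s(x.1, q x), by rw [SimpleGraph.mem_edgeSet, hT]; exact Or.inl (hq x)⟩
    have hF : Function.Surjective F := by
      rintro ⟨e, he⟩
      induction e using Sym2.ind with
      | _ x y =>
        have hmain : ∀ x y, par x y → ∃ z, (F z).1 = s(x, y) := by
          intro x y hxy
          have hx : x ≠ r := by
            rintro rfl
            exact hr y hxy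
          exact ⟨⟨x, hx⟩, by simp only [F]; rw [hfun _ _ _ (hq ⟨x, hx⟩) hxy]⟩
        rw [SimpleGraph.mem_edgeSet, hT] at he
        rcases he with he | he
        · obtain ⟨z, hz⟩ := hmain x y he
          exact ⟨z, Subtype.ext hz⟩
        · obtain ⟨z, hz⟩ := hmain y x he
          exact ⟨z, Subtype.ext (hz.trans Sym2.eq_swap)⟩
    have h1 := Nat.card_le_card_of_surjective F hF
    have h2 : Nat.card {x // x ≠ r} + 1 = Nat.card W := by
      classical
      have := Fintype.ofFinite W
      rw [Nat.card_eq_fintype_card, Nat.card_eq_fintype_card, Fintype.card_subtype_compl,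
        Fintype.card_subtype_eq]
      have : 0 < Fintype.card W := Fintype.card_pos_iff.mpr ⟨r⟩
      omega
    omega
  · refine (SimpleGraph.dist_le ((p x).append (p y).reverse)).trans ?_
    rw [SimpleGraph.Walk.length_append, SimpleGraph.Walk.length_reverse]
    have h1 := hp x
    have h2 := hp y
    have h3 := hB r
    omega

variable {V : Type*} {G : SimpleGraph V}

/-- The subgraph formed by a cluster and its edges between parents and children. -/
def parentSubgraph (G : SimpleGraph V) (cl : V → ℕ) (par : V → V → Prop) (l : ℕ) :
    G.Subgraph where
  verts := {v | cl v = l}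
  Adj u w := G.Adj u w ∧ cl u = l ∧ cl w = l ∧ (par u w ∨ par w u)
  adj_sub h := h.1
  edge_vert h := h.2.1
  symm := ⟨fun _ _ h => ⟨h.1.symm, h.2.2.1, h.2.1, h.2.2.2.symm⟩⟩

theorem parentSubgraph_isTree [Finite V] {cl : V → ℕ} {par : V → V → Prop} {ht : V → ℕ} {B : ℕ}
    (hadj : ∀ x y, par x y → G.Adj x y) (hcl : ∀ x y, par x y → cl x = cl y)
    (hht : ∀ x y, par x y → ht y = ht x + 1) (hfun : ∀ x y z, par x y → par x z → y = z)
    (hroot : ∀ x y, cl x = cl y → (∀ z, ¬ par x z) → (∀ z, ¬ par y z) → x = y)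
    (hB : ∀ x, ht x ≤ B) {l : ℕ} (hl : l ∈ Set.range cl) :
    (parentSubgraph G cl par l).coe.IsTree ∧
      ∀ x y, (parentSubgraph G cl par l).coe.dist x y ≤ 2 * B := by
  obtain ⟨x₀, rfl⟩ := hl
  -- A node of largest height in its cluster has no parent, so it is the root.
  obtain ⟨r, hr, hmax⟩ : ∃ r, cl r = cl x₀ ∧ ∀ y, cl y = cl x₀ → ht y ≤ ht r := by
    obtain ⟨r, hr, hmax⟩ := (Set.toFinite {x | cl x = cl x₀}).exists_maximalFor ht _ ⟨x₀, rfl⟩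
    exact ⟨r, hr, fun y hy => (le_total (ht y) (ht r)).elim id fun h => hmax hy h⟩
  have hr' : ∀ y, cl y = cl x₀ → y ≠ r → ∃ z, par y z := by
    intro y hy hyr
    by_contra! hno
    refine hyr (hroot y r (hy.trans hr.symm) hno fun z hz => ?_)
    have h1 := hht r z hz
    have h2 := hmax z ((hcl r z hz).symm.trans hr)
    omega
  refine isTree_of_parent (par := fun x y => par x.1 y.1) (ht := fun x => ht x.1) (r := ⟨r, hr⟩)
    ?_ (fun x y => hht _ _) (fun x y z h1 h2 => Subtype.ext (hfun _ _ _ h1 h2)) ?_ fun x => hB _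
  · rintro ⟨x, hx⟩ ⟨y, hy⟩
    rw [SimpleGraph.Subgraph.coe_adj]
    refine ⟨fun h => h.2.2.2, fun h => ⟨?_, hx, hy, h⟩⟩
    exact h.elim (hadj x y) fun h => (hadj y x h).symm
  · rintro ⟨x, hx⟩ hxr
    obtain ⟨z, hz⟩ := hr' x hx fun h => hxr (Subtype.ext h)
    exact ⟨⟨z, (hcl x z hz).symm.trans hx⟩, hz⟩

theorem parentSubgraph_isNetworkDecomposition [Finite V] {cl : V → ℕ} {par : V → V → Prop}
    {ht : V → ℕ} {B : ℕ}
    (hadj : ∀ x y, par x y → G.Adj x y) (hcl : ∀ x y, par x y → cl x = cl y)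
    (hht : ∀ x y, par x y → ht y = ht x + 1) (hfun : ∀ x y z, par x y → par x z → y = z)
    (hroot : ∀ x y, cl x = cl y → (∀ z, ¬ par x z) → (∀ z, ¬ par y z) → x = y)
    (hB : ∀ x, ht x ≤ B) {color : ℕ → ℕ} {numColors diam : ℕ} (hdiam : 2 * B ≤ diam)
    (hcolor : ∀ x, color (cl x) ∈ Finset.Icc 1 numColors)
    (hne : ∀ x y, G.Adj x y → cl x ≠ cl y → color (cl x) ≠ color (cl y)) :
    IsNetworkDecomposition (G := G) ⟨cl, color, parentSubgraph G cl par⟩ numColors diam 1 where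
  isTree l hl := (parentSubgraph_isTree hadj hcl hht hfun hroot hB hl).1
  spans _ := rfl
  diam_le l hl x y := ((parentSubgraph_isTree hadj hcl hht hfun hroot hB hl).2 x y).trans hdiam
  color_mem := by
    rintro l ⟨x, rfl⟩
    exact hcolor x
  color_ne := hne
  congestion_le v j := by
    rw [Nat.cast_one, Set.encard_le_one_iff]
    rintro l l' ⟨-, -, hl⟩ ⟨-, -, hl'⟩
    exact hl.symm.trans hl'

end ParentTree

/-! ### The local program and its messages -/

/-- The state of a node. An active node has not yet joined a cluster. -/
structure NodeState where
  ident : ℕ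
  radius : ℕ → ℕ
  clock : ℕ
  active : Prop
  potential : ℕ
  rival : ℕ
  nbrPotential : ℕ → ℕ
  out : NodeOutput

/-- The number with the given binary digits, least significant digit first. -/
def ofBits (l : List Bool) : ℕ := l.foldr Nat.bit 0

theorem ofBits_bits (n : ℕ) : ofBits n.bits = n := by
  induction n using Nat.binaryRec' with
  | zero => simp [ofBits]
  | bit b n h ih =>
    rw [Nat.bits_append_bit n b h]
    simpa [ofBits] using congrArg (Nat.bit b) ih

namespace NodeState

/-- The condition under which a node joins a cluster at the end of a phase. -/
def Joining (M : ℕ) (s : NodeState) : Prop := s.rival + 2 * M ≤ s.potential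

/-- The port `p` is the first one leading to a neighbor whose potential is larger by `M`. -/
def IsParentPort (M : ℕ) (s : NodeState) (p : ℕ) : Prop :=
  s.nbrPotential p = s.potential + M ∧ ∀ q < p, s.nbrPotential q ≠ s.potential + M

/-- The message sent through port `p`, as a number: the two potentials, and a bit telling whether
the edge at `p` belongs to the tree if the node joins a cluster now. -/
noncomputable def message (M : ℕ) (s : NodeState) (p : ℕ) : ℕ :=
  open Classical in
  2 * Nat.pair s.potential s.rival + if s.Joining M ∧ s.IsParentPort M p then 1 else 0

/-- The number received through port `p`. -/
def received (msgs : List (List Bool)) (p : ℕ) : ℕ := ofBits (msgs.getD p [])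

/-- The potential contained in a message. -/
def msgPotential (x : ℕ) : ℕ := (x / 2).unpair.1

/-- The rival potential contained in a message. -/
def msgRival (x : ℕ) : ℕ := (x / 2).unpair.2

/-- One round of the algorithm with phases of `P` rounds. -/
noncomputable def update (M P : ℕ) (s : NodeState) (msgs : List (List Bool)) : NodeState :=
  open Classical in
  { ident := s.ident
    radius := s.radius
    clock := s.clock + 1
    active := s.active ∧ ¬ ((s.clock + 1) % P = 0 ∧ s.Joining M)
    potential := if s.active then max (s.radius (s.clock / P) * M + s.ident)
      ((Finset.range msgs.length).sup fun p => msgPotential (received msgs p) - M) else 0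
    rival := if s.active then (Finset.range msgs.length).sup fun p =>
      if msgPotential (received msgs p) % M = s.potential % M then msgRival (received msgs p) - M
      else msgPotential (received msgs p) - M else 0
    nbrPotential := fun p => msgPotential (received msgs p)
    out := if s.active ∧ (s.clock + 1) % P = 0 ∧ s.Joining M then
      { cluster := s.clock / P * M + s.potential % M
        color := s.clock / P + 1
        treeEdges := ((Finset.range msgs.length).filter fun p =>
          s.IsParentPort M p ∨ received msgs p % 2 = 1).image
            fun p => (s.clock / P * M + s.potential % M, p) } else s.out }

theorem message_div_two (M : ℕ) (s : NodeState) (p : ℕ) :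
    s.message M p / 2 = Nat.pair s.potential s.rival := by
  unfold message
  split_ifs <;> omega

theorem message_mod_two (M : ℕ) (s : NodeState) (p : ℕ) :
    s.message M p % 2 = 1 ↔ s.Joining M ∧ s.IsParentPort M p := by
  unfold message
  split_ifs with h
  · exact ⟨fun _ => h, fun _ => by omega⟩
  · exact ⟨fun _ => by omega, fun h' => (h h').elim⟩

theorem msgPotential_message (M : ℕ) (s : NodeState) (p : ℕ) :
    msgPotential (s.message M p) = s.potential := by
  rw [msgPotential, message_div_two, Nat.unpair_pair]

theorem msgRival_message (M : ℕ) (s : NodeState) (p : ℕ) :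
    msgRival (s.message M p) = s.rival := by
  rw [msgRival, message_div_two, Nat.unpair_pair]

/-- `Nat.pair` of two numbers below `b` is below `b ^ 2`, so a message needs about twice the bits of
a potential. -/
theorem message_lt {M : ℕ} {s : NodeState} {p b q : ℕ} (hp : s.potential < b) (hr : s.rival < b)
    (hq : 2 * b ^ 2 ≤ 2 ^ q) : s.message M p < 2 ^ q := by
  have h1 := Nat.pair_lt_max_add_one_sq s.potential s.rival
  have h2 : (max s.potential s.rival + 1) ^ 2 ≤ b ^ 2 := Nat.pow_le_pow_left (by omega) 2
  unfold message
  split_ifs <;> omega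

theorem IsParentPort.unique {M : ℕ} {s : NodeState} {p q : ℕ} (hp : s.IsParentPort M p)
    (hq : s.IsParentPort M q) : p = q := by
  rcases lt_trichotomy p q with h | h | h
  · exact (hq.2 p h hp.1).elim
  · exact h
  · exact (hp.2 q h hq.1).elim

theorem exists_isParentPort {M : ℕ} {s : NodeState} {p : ℕ}
    (hp : s.nbrPotential p = s.potential + M) : ∃ q ≤ p, s.IsParentPort M q := by
  classical
  have hex : ∃ p, s.nbrPotential p = s.potential + M := ⟨p, hp⟩
  exact ⟨Nat.find hex, Nat.find_min' hex hp, Nat.find_spec hex, fun q hq => Nat.find_min hex hq⟩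

end NodeState

theorem sup_range_degree {V : Type*} [Fintype V] {G : SimpleGraph V} [DecidableRel G.Adj]
    (port : PortNumbering G) (v : V) {h : ℕ → ℕ} {q : V → ℕ}
    (hq : ∀ p : Fin (G.degree v), h p = q (port v p)) :
    (Finset.range (G.degree v)).sup h = (G.neighborFinset v).sup q := by
  refine le_antisymm (Finset.sup_le fun p hp => ?_) (Finset.sup_le fun w hw => ?_)
  · rw [Finset.mem_range] at hp
    have h1 := hq ⟨p, hp⟩
    simp only at h1
    rw [h1]
    exact Finset.le_sup (by rw [SimpleGraph.mem_neighborFinset]; exact (port v ⟨p, hp⟩).2)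
  · rw [SimpleGraph.mem_neighborFinset] at hw
    have h1 := hq ((port v).symm ⟨w, hw⟩)
    rw [Equiv.apply_symm_apply] at h1
    rw [← h1]
    exact Finset.le_sup (Finset.mem_range.mpr (Fin.is_lt _))

/-- The states `st t v` arise from an execution with phases of `2 * B + 4` rounds and messages of at
most `q` bits. -/
structure IsExecution {V : Type*} [Fintype V] {G : SimpleGraph V} [DecidableRel G.Adj]
    (port : PortNumbering G) (M B q : ℕ) (ident : V → ℕ) (radius : V → ℕ → ℕ)
    (st : ℕ → V → NodeState) : Prop where
  init : ∀ v, st 0 v = ⟨ident v, radius v, 0, True, 0, 0, fun _ => 0, ⟨0, 0, ∅⟩⟩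
  step : ∀ t v, st (t + 1) v = (st t v).update M (2 * B + 4) (List.ofFn fun p : Fin (G.degree v) =>
    ((st t (port v p)).message M
      ((port (port v p)).symm ⟨v, (port v p).2.symm⟩ : ℕ)).bits.take q)
  pos : 0 < M
  ident_injective : Function.Injective ident
  ident_lt : ∀ v, ident v < M
  radius_le : ∀ v k, radius v k ≤ B
  fits : 2 * ((B + 1) * M) ^ 2 ≤ 2 ^ q

/-! ### The execution computes both floods -/

namespace IsExecution

variable {V : Type*} [Fintype V] {G : SimpleGraph V} [DecidableRel G.Adj]
  {port : PortNumbering G} {M B q : ℕ} {ident : V → ℕ} {radius : V → ℕ → ℕ}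
  {st : ℕ → V → NodeState}

theorem clock_eq (h : IsExecution port M B q ident radius st) (t : ℕ) (v : V) :
    (st t v).clock = t := by
  induction t with
  | zero => rw [h.init]
  | succ t ih => rw [h.step]; simp [NodeState.update, ih]

theorem ident_eq (h : IsExecution port M B q ident radius st) (t : ℕ) (v : V) :
    (st t v).ident = ident v := by
  induction t with
  | zero => rw [h.init]
  | succ t ih => rw [h.step]; simp [NodeState.update, ih]

theorem radius_eq (h : IsExecution port M B q ident radius st) (t : ℕ) (v : V) :
    (st t v).radius = radius v := by
  induction t with
  | zero => rw [h.init]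
  | succ t ih => rw [h.step]; simp [NodeState.update, ih]

theorem active_succ (h : IsExecution port M B q ident radius st) (t : ℕ) (v : V) :
    (st (t + 1) v).active ↔
      (st t v).active ∧ ¬ ((t + 1) % (2 * B + 4) = 0 ∧ (st t v).Joining M) := by
  rw [h.step]
  simp only [NodeState.update, h.clock_eq]

/-- Bounded potentials make messages short enough for the truncation to `q` bits to lose nothing. -/
theorem received_of_lt (h : IsExecution port M B q ident radius st) {t : ℕ}
    (hb : ∀ w, (st t w).potential < (B + 1) * M ∧ (st t w).rival < (B + 1) * M) (v : V)
    (p : Fin (G.degree v)) :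
    NodeState.received (List.ofFn fun p : Fin (G.degree v) =>
      ((st t (port v p)).message M
        ((port (port v p)).symm ⟨v, (port v p).2.symm⟩ : ℕ)).bits.take q) p =
      (st t (port v p)).message M ((port (port v p)).symm ⟨v, (port v p).2.symm⟩ : ℕ) := by
  unfold NodeState.received
  rw [List.getD_eq_getElem _ _ (by simp), List.getElem_ofFn, List.take_of_length_le, ofBits_bits]
  rw [Nat.size_eq_bits_len, Nat.size_le]
  exact NodeState.message_lt (hb _).1 (hb _).2 h.fits

theorem update_of_bounded (h : IsExecution port M B q ident radius st) {t : ℕ}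
    (hb : ∀ w, (st t w).potential < (B + 1) * M ∧ (st t w).rival < (B + 1) * M) (v : V) :
    open Classical in
    (st (t + 1) v).potential = (if (st t v).active then
      max (radius v (t / (2 * B + 4)) * M + ident v)
        ((G.neighborFinset v).sup fun w => (st t w).potential - M) else 0) ∧
    (st (t + 1) v).rival = (if (st t v).active then
      (G.neighborFinset v).sup fun w => if (st t w).potential % M = (st t v).potential % M then
        (st t w).rival - M else (st t w).potential - M else 0) := by
  rw [h.step]
  simp only [NodeState.update, h.clock_eq, h.ident_eq, h.radius_eq, List.length_ofFn]
  constructor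
  · split_ifs
    · congr 1
      refine sup_range_degree port v fun p => ?_
      rw [h.received_of_lt hb, NodeState.msgPotential_message]
    · rfl
  · split_ifs
    · refine sup_range_degree port v (q := fun w =>
        if (st t w).potential % M = (st t v).potential % M then
        (st t w).rival - M else (st t w).potential - M) fun p => ?_
      rw [h.received_of_lt hb, NodeState.msgPotential_message, NodeState.msgRival_message]
    · rfl

theorem bounded (h : IsExecution port M B q ident radius st) (t : ℕ) :
    ∀ w, (st t w).potential < (B + 1) * M ∧ (st t w).rival < (B + 1) * M := by
  have hpos : 0 < (B + 1) * M := Nat.mul_pos (Nat.succ_pos B) h.pos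
  induction t with
  | zero =>
    intro w
    rw [h.init]
    exact ⟨hpos, hpos⟩
  | succ t ih =>
    intro v
    rw [(h.update_of_bounded ih v).1, (h.update_of_bounded ih v).2]
    constructor
    · split_ifs
      · refine max_lt ?_ ((Finset.sup_lt_iff hpos).mpr fun w _ =>
          lt_of_le_of_lt (Nat.sub_le _ _) (ih w).1)
        have h1 := Nat.mul_le_mul_right M (h.radius_le v (t / (2 * B + 4)))
        have h2 := h.ident_lt v
        have h3 : (B + 1) * M = B * M + M := by ring
        omega
      · exact hpos
    · split_ifs
      · refine (Finset.sup_lt_iff hpos).mpr fun w _ => ?_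
        split_ifs
        · exact lt_of_le_of_lt (Nat.sub_le _ _) (ih w).2
        · exact lt_of_le_of_lt (Nat.sub_le _ _) (ih w).1
      · exact hpos

theorem nbrPotential_succ (h : IsExecution port M B q ident radius st) (t : ℕ) (v : V)
    (p : Fin (G.degree v)) : (st (t + 1) v).nbrPotential p = (st t (port v p)).potential := by
  rw [h.step]
  simp only [NodeState.update]
  rw [h.received_of_lt (h.bounded t), NodeState.msgPotential_message]

theorem out_succ_of_joining (h : IsExecution port M B q ident radius st) {t : ℕ} {v : V}
    (hact : (st t v).active) (ht : (t + 1) % (2 * B + 4) = 0) (hj : (st t v).Joining M) :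
    (st (t + 1) v).out.cluster = t / (2 * B + 4) * M + (st t v).potential % M ∧
    (st (t + 1) v).out.color = t / (2 * B + 4) + 1 ∧
    ∀ l p, (l, p) ∈ (st (t + 1) v).out.treeEdges ↔
      l = t / (2 * B + 4) * M + (st t v).potential % M ∧ ∃ hp : p < G.degree v,
        (st t v).IsParentPort M p ∨ (st t (port v ⟨p, hp⟩)).Joining M ∧
          (st t (port v ⟨p, hp⟩)).IsParentPort M ((port (port v ⟨p, hp⟩)).symm
            ⟨v, (port v ⟨p, hp⟩).2.symm⟩ : ℕ) := by
  have hcond : (st t v).active ∧ ((st t v).clock + 1) % (2 * B + 4) = 0 ∧ (st t v).Joining M := by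
    rw [h.clock_eq]
    exact ⟨hact, ht, hj⟩
  rw [h.step]
  simp only [NodeState.update, if_pos hcond, h.clock_eq, List.length_ofFn, true_and,
    Finset.mem_image, Finset.mem_filter, Finset.mem_range, Prod.mk.injEq]
  intro l p
  constructor
  · rintro ⟨p', ⟨hp, hp'⟩, rfl, rfl⟩
    refine ⟨rfl, hp, hp'.imp id fun hx => ?_⟩
    have := h.received_of_lt (h.bounded t) v ⟨p', hp⟩
    simp only at this
    rw [this] at hx
    exact (NodeState.message_mod_two _ _ _).mp hx
  · rintro ⟨rfl, hp, hp'⟩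
    refine ⟨p, ⟨hp, hp'.imp id fun hx => ?_⟩, rfl, rfl⟩
    have := h.received_of_lt (h.bounded t) v ⟨p, hp⟩
    simp only at this
    rw [this]
    exact (NodeState.message_mod_two _ _ _).mpr hx

theorem not_active_of_le (h : IsExecution port M B q ident radius st) {t t' : ℕ} (htt : t ≤ t')
    {v : V} (hv : ¬ (st t v).active) : ¬ (st t' v).active ∧ (st t' v).out = (st t v).out := by
  induction t', htt using Nat.le_induction with
  | base => exact ⟨hv, rfl⟩
  | succ t' _ ih =>
    refine ⟨fun hact => ih.1 ((h.active_succ t' v).mp hact).1, ?_⟩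
    rw [← ih.2, h.step]
    simp [NodeState.update, ih.1]

/-- The nodes that are active in phase `k`. -/
def activeSet (B : ℕ) (st : ℕ → V → NodeState) (k : ℕ) : Set V :=
  {v | (st (k * (2 * B + 4)) v).active}

/-- Nodes leave only in the update that ends a phase, so both floods of a phase see the same active
set. -/
theorem active_iff (h : IsExecution port M B q ident radius st) (k : ℕ) {i : ℕ}
    (hi : i < 2 * B + 4) (v : V) :
    (st (k * (2 * B + 4) + i) v).active ↔ v ∈ activeSet B st k := by
  induction i with
  | zero => rfl
  | succ i ih =>
    rw [← add_assoc, h.active_succ, ih (by omega)]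
    refine and_iff_left fun h' => ?_
    rw [add_assoc, Nat.mul_add_mod', Nat.mod_eq_of_lt hi] at h'
    omega

/-- The neighbors of an active node. -/
noncomputable def activeNbrs (G : SimpleGraph V) [DecidableRel G.Adj] (A : Set V) (v : V) :
    Finset V :=
  open Classical in if v ∈ A then G.neighborFinset v else ∅

theorem mem_activeNbrs {A : Set V} {v w : V} : w ∈ activeNbrs G A v ↔ v ∈ A ∧ G.Adj v w := by
  unfold activeNbrs
  split_ifs with hv <;> simp [hv]

theorem activeNbrs_of_notMem {A : Set V} : ∀ v ∉ A, activeNbrs G A v = ∅ := by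
  intro v hv
  simp [activeNbrs, hv]

theorem potential_succ (h : IsExecution port M B q ident radius st) (k : ℕ) {i : ℕ}
    (hi : i < 2 * B + 4) (v : V) :
    (st (k * (2 * B + 4) + (i + 1)) v).potential =
      max (shiftKey M (activeSet B st k) ident (fun v => radius v k) v)
        ((activeNbrs G (activeSet B st k) v).sup fun w =>
          (st (k * (2 * B + 4) + i) w).potential - M) := by
  have hdiv : (k * (2 * B + 4) + i) / (2 * B + 4) = k := by
    rw [mul_comm, Nat.mul_add_div (by omega), Nat.div_eq_of_lt hi, add_zero]
  rw [← add_assoc, (h.update_of_bounded (h.bounded _) v).1, hdiv]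
  have hact := h.active_iff k hi v
  by_cases hv : v ∈ activeSet B st k
  · rw [if_pos (hact.mpr hv), shiftKey_of_mem hv, activeNbrs, if_pos hv]
  · rw [if_neg (mt hact.mp hv), shiftKey_of_notMem hv, activeNbrs, if_neg hv]
    simp

theorem rival_succ (h : IsExecution port M B q ident radius st) (k : ℕ) {i : ℕ}
    (hi : i < 2 * B + 4) {f : V → ℕ}
    (hf : ∀ v, (st (k * (2 * B + 4) + i) v).potential = f v) (v : V) :
    (st (k * (2 * B + 4) + (i + 1)) v).rival =
      max (rivalKey M (activeNbrs G (activeSet B st k)) f v)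
        ((sameCenter M (activeNbrs G (activeSet B st k)) f v).sup fun w =>
          (st (k * (2 * B + 4) + i) w).rival - M) := by
  rw [← add_assoc, (h.update_of_bounded (h.bounded _) v).2]
  have hact := h.active_iff k hi v
  simp only [hf]
  by_cases hv : v ∈ activeSet B st k
  · rw [if_pos (hact.mpr hv), rivalKey, sameCenter, activeNbrs, if_pos hv, Finset.sup_ite, sup_comm]
  · rw [if_neg (mt hact.mp hv), rivalKey, sameCenter, activeNbrs, if_neg hv]
    simp

/-- The last round of phase `k`. -/
def lastRound (B k : ℕ) : ℕ := k * (2 * B + 4) + (2 * B + 3)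

theorem lastRound_add_one (B k : ℕ) : lastRound B k + 1 = (k + 1) * (2 * B + 4) := by
  unfold lastRound
  ring

theorem lastRound_div (B k : ℕ) : lastRound B k / (2 * B + 4) = k := by
  rw [lastRound, mul_comm, Nat.mul_add_div (by omega), Nat.div_eq_of_lt (by omega), add_zero]

theorem potential_eq (h : IsExecution port M B q ident radius st) (k : ℕ) {i : ℕ}
    (hi : B + 1 ≤ i) (hi' : i ≤ 2 * B + 3) (v : V) :
    (st (k * (2 * B + 4) + i) v).potential = (st (lastRound B k) v).potential := by
  have key : ∀ {i : ℕ}, B + 1 ≤ i → i ≤ 2 * B + 3 →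
      (fun v => (st (k * (2 * B + 4) + i) v).potential) =
        fun v => (st (k * (2 * B + 4) + (B + 1)) v).potential := fun {i} hi hi' =>
    flood_stabilises (h := fun i v => (st (k * (2 * B + 4) + i) v).potential)
      (fun i hi v => h.potential_succ k hi v) (fun v => (h.bounded _ v).1)
      (shiftKey_lt h.pos h.ident_lt fun v => h.radius_le v k) hi (by omega)
  exact congrFun ((key hi hi').trans (key (i := 2 * B + 3) (by omega) le_rfl).symm) v

theorem isPotential_potential (h : IsExecution port M B q ident radius st) (k : ℕ) :
    IsPotential M (activeNbrs G (activeSet B st k))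
      (shiftKey M (activeSet B st k) ident fun v => radius v k)
      fun v => (st (lastRound B k) v).potential := by
  intro v
  refine (h.potential_succ k (i := 2 * B + 2) (by omega) v).trans ?_
  simp only [h.potential_eq k (i := 2 * B + 2) (by omega) (by omega)]

/-- Potentials are constant from offset `B + 1` on. From there the rival values obey a fixed flood
equation, starting from arbitrary bounded values, and settle after `B + 1` more rounds. The last
state of the phase has offset `2 * B + 3`, which is one round later. -/
theorem isPotential_rival (h : IsExecution port M B q ident radius st) (k : ℕ) :
    IsPotential M
      (sameCenter M (activeNbrs G (activeSet B st k)) fun v => (st (lastRound B k) v).potential)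
      (rivalKey M (activeNbrs G (activeSet B st k)) fun v => (st (lastRound B k) v).potential)
      fun v => (st (lastRound B k) v).rival := by
  have hstep : ∀ i < B + 3, ∀ v, (st (k * (2 * B + 4) + (B + 1 + (i + 1))) v).rival =
      max (rivalKey M (activeNbrs G (activeSet B st k))
          (fun v => (st (lastRound B k) v).potential) v)
        ((sameCenter M (activeNbrs G (activeSet B st k))
          (fun v => (st (lastRound B k) v).potential) v).sup fun w =>
          (st (k * (2 * B + 4) + (B + 1 + i)) w).rival - M) := fun i hi v => by
    rw [← add_assoc (B + 1)]
    exact h.rival_succ k (by omega) (fun v => h.potential_eq k (by omega) (by omega) v) v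
  have hpos : 0 < (B + 1) * M := Nat.mul_pos (Nat.succ_pos B) h.pos
  have hkey : ∀ v, rivalKey M (activeNbrs G (activeSet B st k))
      (fun v => (st (lastRound B k) v).potential) v < (B + 1) * M := fun v =>
    (Finset.sup_lt_iff hpos).mpr fun w _ =>
      lt_of_le_of_lt (Nat.sub_le _ _) (h.bounded _ w).1
  have hstab := flood_stabilises (h := fun i v => (st (k * (2 * B + 4) + (B + 1 + i)) v).rival)
    hstep (fun v => (h.bounded _ v).2) hkey (i := B + 2) (by omega) (by omega)
  have hpot := flood_isPotential (h := fun i v => (st (k * (2 * B + 4) + (B + 1 + i)) v).rival)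
    hstep (fun v => (h.bounded _ v).2) hkey (by omega)
  rw [← hstab] at hpot
  have he : lastRound B k = k * (2 * B + 4) + (B + 1 + (B + 2)) := by
    unfold lastRound
    ring
  rw [he] at hpot ⊢
  exact hpot

theorem joins_iff (h : IsExecution port M B q ident radius st) (k : ℕ) (v : V) :
    Joins M (activeNbrs G (activeSet B st k))
      (shiftKey M (activeSet B st k) ident fun v => radius v k) v ↔
      (st (lastRound B k) v).Joining M := by
  refine ⟨fun hj => hj _ _ (h.isPotential_potential k) (h.isPotential_rival k), ?_⟩
  intro hj f g hf hg
  obtain rfl := (h.isPotential_potential k).unique h.pos hf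
  obtain rfl := (h.isPotential_rival k).unique h.pos hg
  exact hj

theorem mem_activeSet_succ (h : IsExecution port M B q ident radius st) (k : ℕ) (v : V) :
    v ∈ activeSet B st (k + 1) ↔
      v ∈ activeSet B st k ∧ ¬ (st (lastRound B k) v).Joining M := by
  have h1 := h.active_succ (lastRound B k) v
  rw [lastRound_add_one, Nat.mul_mod_left] at h1
  rw [← h.active_iff k (i := 2 * B + 3) (by omega)]
  exact h1.trans (and_congr_right fun _ => not_congr (and_iff_right rfl))

theorem nbrPotential_lastRound (h : IsExecution port M B q ident radius st) (k : ℕ) (v : V)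
    (p : Fin (G.degree v)) :
    (st (lastRound B k) v).nbrPotential p = (st (lastRound B k) (port v p)).potential := by
  have h1 := h.nbrPotential_succ (k * (2 * B + 4) + (2 * B + 2)) v p
  rw [h.potential_eq k (by omega) (by omega)] at h1
  exact h1

end IsExecution

/-! ### Clusters, parents and the correctness of the output -/

namespace IsExecution

variable {V : Type*} [Fintype V] {G : SimpleGraph V} [DecidableRel G.Adj]
  {port : PortNumbering G} {M B q : ℕ} {ident : V → ℕ} {radius : V → ℕ → ℕ}
  {st : ℕ → V → NodeState}

theorem mem_activeSet_zero (h : IsExecution port M B q ident radius st) {v : V} :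
    v ∈ activeSet B st 0 := by
  have hv : (st (0 * (2 * B + 4)) v).active := by
    rw [zero_mul, h.init]
    trivial
  exact hv

theorem activeSet_subset (h : IsExecution port M B q ident radius st) {k k' : ℕ} (hk : k ≤ k')
    {v : V} (hv : v ∈ activeSet B st k') : v ∈ activeSet B st k := by
  by_contra hv'
  exact (h.not_active_of_le (Nat.mul_le_mul_right _ hk) hv').1 hv

/-- The phase in which a node joins is unique. -/
theorem phase_unique (h : IsExecution port M B q ident radius st) {k k' : ℕ} {v : V}
    (hk : v ∈ activeSet B st k) (hj : (st (lastRound B k) v).Joining M)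
    (hk' : v ∈ activeSet B st k') (hj' : (st (lastRound B k') v).Joining M) : k = k' := by
  have h1 : v ∉ activeSet B st (k + 1) := fun h' => ((h.mem_activeSet_succ k v).mp h').2 hj
  have h2 : v ∉ activeSet B st (k' + 1) := fun h' => ((h.mem_activeSet_succ k' v).mp h').2 hj'
  rcases lt_trichotomy k k' with hlt | heq | hlt
  · exact (h1 (h.activeSet_subset hlt hk')).elim
  · exact heq
  · exact (h2 (h.activeSet_subset hlt hk)).elim

theorem exists_phase (h : IsExecution port M B q ident radius st) {T : ℕ} {v : V}
    (hv : v ∉ activeSet B st T) :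
    ∃ k < T, v ∈ activeSet B st k ∧ (st (lastRound B k) v).Joining M := by
  induction T with
  | zero =>
    exact (hv h.mem_activeSet_zero).elim
  | succ T ih =>
    by_cases hT : v ∈ activeSet B st T
    · refine ⟨T, Nat.lt_succ_self T, hT, ?_⟩
      by_contra hj
      exact hv ((h.mem_activeSet_succ T v).mpr ⟨hT, hj⟩)
    · obtain ⟨k, hk, hk'⟩ := ih hT
      exact ⟨k, hk.trans (Nat.lt_succ_self T), hk'⟩

theorem mem_activeSet_of_pos (h : IsExecution port M B q ident radius st) {k : ℕ} {v : V}
    (hv : 0 < (st (lastRound B k) v).potential) : v ∈ activeSet B st k :=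
  (h.isPotential_potential k).mem_of_pos activeNbrs_of_notMem (fun _ => shiftKey_of_notMem) hv

theorem mem_activeSet_of_joining (h : IsExecution port M B q ident radius st) {k : ℕ} {v : V}
    (hv : (st (lastRound B k) v).Joining M) : v ∈ activeSet B st k := by
  refine h.mem_activeSet_of_pos ?_
  have := h.pos
  unfold NodeState.Joining at hv
  omega

/-- At the end of phase `k`, the node `w` is the parent of the node `v`. -/
def IsParent (port : PortNumbering G) (M B : ℕ) (st : ℕ → V → NodeState) (k : ℕ) (v w : V) :
    Prop :=
  ∃ p : Fin (G.degree v), port v p = w ∧ (st (lastRound B k) v).IsParentPort M p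

theorem IsParent.adj {k : ℕ} {v w : V} (hp : IsParent port M B st k v w) : G.Adj v w := by
  obtain ⟨p, rfl, -⟩ := hp
  exact (port v p).2

theorem IsParent.unique {k : ℕ} {v w w' : V} (hp : IsParent port M B st k v w)
    (hp' : IsParent port M B st k v w') : w = w' := by
  obtain ⟨p, rfl, hp⟩ := hp
  obtain ⟨p', rfl, hp'⟩ := hp'
  rw [Fin.ext (hp.unique hp')]

theorem potential_of_isParent (h : IsExecution port M B q ident radius st) {k : ℕ} {v w : V}
    (hp : IsParent port M B st k v w) :
    (st (lastRound B k) w).potential = (st (lastRound B k) v).potential + M := by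
  obtain ⟨p, rfl, hp⟩ := hp
  rw [← h.nbrPotential_lastRound, hp.1]

/-- Towards the parent the potential grows by exactly `M` and the rival value by at most `M`, so the
margin is kept. -/
theorem joining_of_isParent (h : IsExecution port M B q ident radius st) {k : ℕ} {v w : V}
    (hv : v ∈ activeSet B st k) (hj : (st (lastRound B k) v).Joining M)
    (hp : IsParent port M B st k v w) : (st (lastRound B k) w).Joining M := by
  have h1 := h.potential_of_isParent hp
  have h2 : w ∈ sameCenter M (activeNbrs G (activeSet B st k))
      (fun v => (st (lastRound B k) v).potential) v := by
    rw [sameCenter, Finset.mem_filter, mem_activeNbrs, h1, Nat.add_mod_right]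
    exact ⟨⟨hv, hp.adj⟩, rfl⟩
  have h3 := (h.isPotential_rival k).le_add h2
  unfold NodeState.Joining at hj ⊢
  omega

/-- A node without a parent keeps its own key, so it is its own center. Injectivity of the
identifiers then leaves only one root per cluster. -/
theorem exists_isParent (h : IsExecution port M B q ident radius st) {k : ℕ} {v : V}
    (hv : v ∈ activeSet B st k) : (st (lastRound B k) v).potential % M = ident v ∨
      ∃ w, IsParent port M B st k v w := by
  rcases (h.isPotential_potential k).eq_key_or_exists v with h1 | ⟨w, hw, h1⟩
  · left
    rw [h1, shiftKey_of_mem hv, mul_add_mod_of_lt_right _ (h.ident_lt v)]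
  · right
    have hadj : G.Adj v w := (mem_activeNbrs.mp hw).2
    obtain ⟨p, hp⟩ : ∃ p, port v p = ⟨w, hadj⟩ := (port v).surjective _
    have h2 := h.nbrPotential_lastRound k v p
    rw [hp] at h2
    obtain ⟨p', hp', hpar⟩ := NodeState.exists_isParentPort (h2.trans h1)
    exact ⟨_, ⟨p', lt_of_le_of_lt hp' p.2⟩, rfl, hpar⟩

/-- With different centers, each potential minus `M` is a rival value for the other node. Both
margins together would make each potential exceed the other by `M`. -/
theorem center_eq_of_adj (h : IsExecution port M B q ident radius st) {k : ℕ} {v w : V}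
    (hvw : G.Adj v w)
    (hv : (st (lastRound B k) v).Joining M) (hw : (st (lastRound B k) w).Joining M) :
    (st (lastRound B k) v).potential % M = (st (lastRound B k) w).potential % M := by
  by_contra hne
  have key : ∀ v w, G.Adj v w → (st (lastRound B k) v).Joining M →
      (st (lastRound B k) v).potential % M ≠ (st (lastRound B k) w).potential % M →
      (st (lastRound B k) w).potential + M ≤ (st (lastRound B k) v).potential := by
    intro v w hvw hv hne
    have h1 := (h.isPotential_rival k).key_le v
    have h2 : (st (lastRound B k) w).potential - M ≤
        rivalKey M (activeNbrs G (activeSet B st k))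
          (fun v => (st (lastRound B k) v).potential) v := by
      refine Finset.le_sup (f := fun w => (st (lastRound B k) w).potential - M) ?_
      rw [Finset.mem_filter, mem_activeNbrs]
      exact ⟨⟨h.mem_activeSet_of_joining hv, hvw⟩, hne.symm⟩
    unfold NodeState.Joining at hv
    omega
  have h1 := key v w hvw hv hne
  have h2 := key w v hvw.symm hw (Ne.symm hne)
  have := h.pos
  omega

/-- If no node is active after `T` phases, the outputs form a network decomposition. -/
theorem exists_isNetworkDecomposition (h : IsExecution port M B q ident radius st)
    {T numColors diam : ℕ}
    (hcol : T ≤ numColors) (hdiam : 2 * B ≤ diam) (hT : ∀ v, v ∉ activeSet B st T) :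
    ∃ D : ClusterData G, IsNetworkDecomposition D numColors diam 1 ∧
      IsLocalView port D fun v => (st (T * (2 * B + 4)) v).out := by
  have hpos := h.pos
  choose ph hphT hact hjoin using fun v => h.exists_phase (hT v)
  set F : V → ℕ := fun v => (st (lastRound B (ph v)) v).potential with hF
  -- Phase and center are the quotient and residue of the name, so the color can be read off the
  -- name.
  set cl : V → ℕ := fun v => ph v * M + F v % M with hcl
  set par : V → V → Prop := fun v w => IsParent port M B st (ph v) v w with hpar
  have hph : ∀ {k v}, (st (lastRound B k) v).Joining M → ph v = k := fun {k v} hj =>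
    h.phase_unique (hact v) (hjoin v) (h.mem_activeSet_of_joining hj) hj
  have hcl_div : ∀ v, cl v / M = ph v := fun v => by
    simp only [hcl]
    rw [mul_comm, Nat.mul_add_div hpos, Nat.div_eq_of_lt (Nat.mod_lt _ hpos), add_zero]
  have hcl_mod : ∀ v, cl v % M = F v % M := fun v =>
    mul_add_mod_of_lt_right _ (Nat.mod_lt _ hpos)
  have hpar_ph : ∀ v w, par v w → ph w = ph v := fun v w hvw =>
    hph (h.joining_of_isParent (hact v) (hjoin v) hvw)
  have hpar_F : ∀ v w, par v w → F w = F v + M := by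
    intro v w hvw
    simp only [hF]
    rw [hpar_ph v w hvw, h.potential_of_isParent hvw]
  have hpar_cl : ∀ v w, par v w → cl v = cl w := by
    intro v w hvw
    simp only [hcl]
    rw [hpar_ph v w hvw, hpar_F v w hvw, Nat.add_mod_right]
  refine ⟨⟨cl, fun l => l / M + 1, parentSubgraph G cl par⟩,
    parentSubgraph_isNetworkDecomposition (ht := fun v => F v / M) (B := B)
      (fun v w hvw => hvw.adj) hpar_cl ?_ (fun v w w' => IsParent.unique) ?_ ?_ hdiam ?_ ?_, ?_⟩
  · intro v w hvw
    rw [hpar_F v w hvw, Nat.add_div_right _ hpos]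
  · intro v w hvw hv hw
    apply h.ident_injective
    have h1 := (h.exists_isParent (hact v)).resolve_right fun ⟨z, hz⟩ => hv z hz
    have h2 := (h.exists_isParent (hact w)).resolve_right fun ⟨z, hz⟩ => hw z hz
    rw [← h1, ← h2]
    exact (hcl_mod v).symm.trans (hvw ▸ hcl_mod w)
  · intro v
    exact Nat.le_of_lt_succ ((Nat.div_lt_iff_lt_mul hpos).mpr (h.bounded _ v).1)
  · intro v
    rw [hcl_div, Finset.mem_Icc]
    exact ⟨by omega, (Nat.succ_le_of_lt (hphT v)).trans hcol⟩
  · intro v w hvw hne heq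
    simp only [hcl_div, add_left_inj] at heq
    refine hne ?_
    have hw := hjoin w
    have := h.center_eq_of_adj hvw (hjoin v) (heq ▸ hw)
    simp only [hcl, hF]
    rw [← heq, this]
  · intro v
    have hnot : ¬ (st (lastRound B (ph v) + 1) v).active := by
      rw [lastRound_add_one]
      exact fun h' => ((h.mem_activeSet_succ (ph v) v).mp h').2 (hjoin v)
    have hle : lastRound B (ph v) + 1 ≤ T * (2 * B + 4) := by
      rw [lastRound_add_one]
      exact Nat.mul_le_mul_right _ (hphT v)
    have hlast : (st (lastRound B (ph v)) v).active :=
      (h.active_iff (ph v) (i := 2 * B + 3) (by omega) v).mpr (hact v)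
    obtain ⟨o1, o2, o3⟩ := h.out_succ_of_joining hlast
      (by rw [lastRound_add_one, Nat.mul_mod_left]) (hjoin v)
    rw [lastRound_div] at o1 o2 o3
    simp only [(h.not_active_of_le hle hnot).2]
    refine ⟨o1, by rw [o2, hcl_div], fun l p => ?_⟩
    rw [o3]
    constructor
    · rintro ⟨rfl, hp, hor⟩
      refine ⟨⟨v, rfl⟩, hp, (port v ⟨p, hp⟩).2, rfl, ?_⟩
      rcases hor with hor | ⟨hj, hor⟩
      · have hvw : par v (port v ⟨p, hp⟩) := ⟨⟨p, hp⟩, rfl, hor⟩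
        exact ⟨(hpar_cl _ _ hvw).symm, Or.inl hvw⟩
      · have hwv : par (port v ⟨p, hp⟩) v := by
          simp only [hpar]
          rw [hph hj]
          exact ⟨_, by rw [Equiv.apply_symm_apply], hor⟩
        exact ⟨hpar_cl _ _ hwv, Or.inr hwv⟩
    · rintro ⟨-, hp, -, hl, hlw, hor⟩
      refine ⟨hl.symm, hp, hor.imp ?_ ?_⟩
      · rintro ⟨p', hp', hpp⟩
        have : p' = ⟨p, hp⟩ := (port v).injective (Subtype.ext hp')
        rwa [this] at hpp
      · intro hwv
        -- The neighbor is a child, so `v` joined in the same phase, and the child announced the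
        -- edge in that round.
        have hphw : ph v = ph (port v ⟨p, hp⟩) := hpar_ph _ _ hwv
        rw [hphw]
        refine ⟨hjoin _, ?_⟩
        obtain ⟨p', hp', hpp⟩ := hwv
        have : p' = (port (port v ⟨p, hp⟩)).symm ⟨v, (port v ⟨p, hp⟩).2.symm⟩ := by
          rw [Equiv.eq_symm_apply]
          exact Subtype.ext hp'
        rwa [this] at hpp

end IsExecution

/-! ### Shared bits, seeds and radii -/

section Randomness

/-- A union bound through a random variable that is at least `1` off the event. -/
theorem one_sub_le_probBits {k : ℕ} {P : (Fin k → Bool) → Prop} {X : (Fin k → Bool) → ℝ}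
    (h0 : ∀ r, 0 ≤ X r) (h1 : ∀ r, ¬ P r → 1 ≤ X r) : 1 - (∑ r, X r) / 2 ^ k ≤ probBits P := by
  classical
  have hcard : (Nat.card {r // P r} : ℝ) = ∑ r, if P r then 1 else 0 := by
    rw [Nat.card_eq_fintype_card, Fintype.card_subtype]
    simp
  have hsum : (2 : ℝ) ^ k ≤ (Nat.card {r // P r} : ℝ) + ∑ r, X r := by
    rw [hcard, ← Finset.sum_add_distrib]
    calc (2 : ℝ) ^ k = ∑ _r : Fin k → Bool, (1 : ℝ) := by simp
      _ ≤ _ := Finset.sum_le_sum fun r _ => by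
        split_ifs with h
        · linarith [h0 r]
        · linarith [h1 r h]
  rw [probBits, sub_le_iff_le_add, ← add_div, one_le_div (by positivity)]
  exact hsum

/-- The decomposition of a string of `T * s` bits into `T` seeds of `s` bits. -/
def splitBits (T s : ℕ) : (Fin (T * s) → Bool) ≃ (Fin T → Fin s → Bool) :=
  (Equiv.arrowCongr finProdFinEquiv.symm (Equiv.refl Bool)).trans (Equiv.curry _ _ _)

/-- The radius of the node with identifier `i` in the phase with seed `j`. -/
def tableRadius {m B s : ℕ} (σ : (Fin s → Bool) → Fin (2 ^ m) → Fin (B + 1)) (i : ℕ)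
    (j : Fin s → Bool) : ℕ :=
  if h : i < 2 ^ m then σ j ⟨i, h⟩ else 0

theorem tableRadius_le {m B s : ℕ} (σ : (Fin s → Bool) → Fin (2 ^ m) → Fin (B + 1)) (i : ℕ)
    (j : Fin s → Bool) : tableRadius σ i j ≤ B := by
  unfold tableRadius
  split_ifs
  · exact Nat.lt_succ_iff.mp (Fin.is_lt _)
  · exact Nat.zero_le _

end Randomness

/-! ### The algorithm and its success probability -/

section Algorithm

/-- The algorithm with identifiers of `m n` bits, radii at most `B n`, `T n` phases, and the tables
`σ n` that turn the seed of a phase into the radii of all nodes. -/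
noncomputable def decompositionAlgorithm (m B T : ℕ → ℕ)
    (σ : ∀ n, (Fin (2 * m n + 8) → Bool) → Fin (2 ^ m n) → Fin (B n + 1)) :
    SharedRandomCongestAlgorithm where
  sharedBits n := T n * (2 * m n + 8)
  rounds n := T n * (2 * B n + 4)
  msgBits n := 2 * (m n + B n) + 1
  State := NodeState
  init n i _ r := ⟨i,
    fun k => tableRadius (σ n) i (extendSeeds (fun _ => false) (splitBits _ _ r) k),
    0, True, 0, 0, fun _ => 0, ⟨0, 0, ∅⟩⟩
  send n s p := (s.message (2 ^ m n) p).bits.take (2 * (m n + B n) + 1)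
  send_length_le _ _ _ := List.length_take_le _ _
  receive n s msgs := s.update (2 ^ m n) (2 * B n + 4) msgs
  output _ s := s.out

variable {V : Type*} [Fintype V] {G : SimpleGraph V} [DecidableRel G.Adj]

theorem isExecution_decompositionAlgorithm {m B T : ℕ → ℕ}
    {σ : ∀ n, (Fin (2 * m n + 8) → Bool) → Fin (2 ^ m n) → Fin (B n + 1)} {n : ℕ}
    {ident : V → ℕ} (port : PortNumbering G) (hinj : Function.Injective ident)
    (hid : ∀ v, ident v < 2 ^ m n) (r : Fin (T n * (2 * m n + 8)) → Bool) :
    IsExecution port (2 ^ m n) (B n) (2 * (m n + B n) + 1) ident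
      (fun v k => tableRadius (σ n) (ident v)
        (extendSeeds (fun _ => false) (splitBits _ _ r) k))
      ((decompositionAlgorithm m B T σ).stateAfter n G ident port r) where
  init _ := rfl
  step _ _ := rfl
  pos := by positivity
  ident_injective := hinj
  ident_lt := hid
  radius_le _ _ := tableRadius_le _ _ _
  fits := by
    have h1 : B n + 1 ≤ 2 ^ B n := Nat.lt_two_pow_self
    calc 2 * ((B n + 1) * 2 ^ m n) ^ 2 ≤ 2 * (2 ^ B n * 2 ^ m n) ^ 2 := by gcongr
      _ = 2 ^ (2 * (m n + B n) + 1) := by ring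

/-- The nodes of `A` that do not join a cluster in a phase with seed `j`. -/
noncomputable def phaseStep (G : SimpleGraph V) [DecidableRel G.Adj] (ident : V → ℕ) {m B s : ℕ}
    (σ : (Fin s → Bool) → Fin (2 ^ m) → Fin (B + 1)) (j : Fin s → Bool) (A : Finset V) :
    Finset V :=
  open Classical in A.filter fun v => ¬ Joins (2 ^ m) (IsExecution.activeNbrs G A)
    (shiftKey (2 ^ m) A ident fun v => tableRadius σ (ident v) j) v

theorem phaseStep_subset {ident : V → ℕ} {m B s : ℕ}
    {σ : (Fin s → Bool) → Fin (2 ^ m) → Fin (B + 1)} (j : Fin s → Bool) (A : Finset V) :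
    phaseStep G ident σ j A ⊆ A := by
  classical
  intro v hv
  rw [phaseStep, Finset.mem_filter] at hv
  exact hv.1

theorem activeSet_eq_leftover {m B s q : ℕ} {ident : V → ℕ} {port : PortNumbering G}
    {σ : (Fin s → Bool) → Fin (2 ^ m) → Fin (B + 1)} {J : ℕ → Fin s → Bool}
    {st : ℕ → V → NodeState}
    (h : IsExecution port (2 ^ m) B q ident (fun v k => tableRadius σ (ident v) (J k)) st)
    (k : ℕ) :
    IsExecution.activeSet B st k = leftover (phaseStep G ident σ) Finset.univ J k := by
  induction k with
  | zero =>
    ext v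
    simp [leftover, h.mem_activeSet_zero]
  | succ k ih =>
    ext v
    have h1 := h.joins_iff k v
    rw [ih] at h1
    rw [h.mem_activeSet_succ, ih, leftover, phaseStep, Finset.coe_filter, Set.mem_ofPred_eq, h1,
      Finset.mem_coe]

/-- The network is placed on `Fin (2 ^ m)` by identifiers. There the table makes `u` join for `1 /
16` of the seeds, whatever the active set is. -/
theorem card_mem_phaseStep_le {m B : ℕ}
    {σ : (Fin (2 * m + 8) → Bool) → Fin (2 ^ m) → Fin (B + 1)}
    (hσ : ∀ (R : Fin (2 ^ m) → Finset (Fin (2 ^ m))) (S : Finset (Fin (2 ^ m))) (u : Fin (2 ^ m)),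
        (S.card : ℝ) * (2 * (1 / 2) ^ (B - 1)) ≤ 1 / 2 → (∀ x ∉ S, R x = ∅) → u ∈ S →
          2 ^ (2 * m + 4) ≤ Nat.card {j // Joins (2 ^ m) R
            (shiftKey (2 ^ m) S (fun x => x) fun x => σ j x) u})
    {ident : V → ℕ} (hinj : Function.Injective ident) (hid : ∀ v, ident v < 2 ^ m)
    (hcard : (Fintype.card V : ℝ) * (2 * (1 / 2) ^ (B - 1)) ≤ 1 / 2) {A : Finset V} {u : V}
    (hu : u ∈ A) :
    (Nat.card {j // u ∈ phaseStep G ident σ j A} : ℝ) ≤ 15 / 16 * 2 ^ (2 * m + 8) := by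
  classical
  let φ : V ↪ Fin (2 ^ m) := ⟨fun v => ⟨ident v, hid v⟩, fun v w h => hinj (Fin.ext_iff.mp h)⟩
  let R : Fin (2 ^ m) → Finset (Fin (2 ^ m)) := fun x =>
    if x ∈ A.map φ then Finset.univ.filter fun y => (G.map φ).Adj x y else ∅
  have hR : ∀ v, R (φ v) = (IsExecution.activeNbrs G A v).map φ := by
    intro v
    by_cases hv : v ∈ A
    · have hRv : R (φ v) = Finset.univ.filter fun y => (G.map φ).Adj (φ v) y :=
        if_pos ((Finset.mem_map' φ).mpr hv)
      ext y
      simp only [hRv, hv, Finset.mem_filter, Finset.mem_univ, true_and,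
        SimpleGraph.map_adj, Finset.mem_map, IsExecution.mem_activeNbrs, Finset.mem_coe]
      constructor
      · rintro ⟨v', w, hadj, hv', rfl⟩
        exact ⟨w, φ.injective hv' ▸ hadj, rfl⟩
      · rintro ⟨w, hadj, rfl⟩
        exact ⟨v, w, hadj, rfl, rfl⟩
    · simp only [R, Finset.mem_map' φ, hv, if_false]
      rw [IsExecution.activeNbrs_of_notMem v (by simpa using hv), Finset.map_empty]
  have hR' : ∀ x ∉ A.map φ, R x = ∅ := fun x hx => if_neg hx
  have hmap : ∀ x, x ∈ A.map φ → x ∈ Set.range φ := by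
    intro x hx
    obtain ⟨v, -, rfl⟩ := Finset.mem_map.mp hx
    exact ⟨v, rfl⟩
  have hS : ((A.map φ).card : ℝ) * (2 * (1 / 2) ^ (B - 1)) ≤ 1 / 2 := by
    refine le_trans ?_ hcard
    rw [Finset.card_map]
    gcongr
    exact_mod_cast Finset.card_le_univ A
  have hmain := hσ R (A.map φ) (φ u) hS hR' ((Finset.mem_map' φ).mpr hu)
  have himp : ∀ j, Joins (2 ^ m) R
      (shiftKey (2 ^ m) (A.map φ) (fun x => x) fun x => σ j x) (φ u) →
      u ∉ phaseStep G ident σ j A := by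
    intro j hj hmem
    rw [phaseStep, Finset.mem_filter] at hmem
    refine hmem.2 (hj.of_embedding hR (fun x hx => hR' x (mt (hmap x) hx)) ?_ ?_)
    · intro v
      by_cases hv : v ∈ A
      · rw [shiftKey_of_mem (by simpa using hv), shiftKey_of_mem (by simpa using hv)]
        rw [tableRadius, dif_pos (hid v)]
        rfl
      · rw [shiftKey_of_notMem (by simpa using hv), shiftKey_of_notMem (by simpa using hv)]
    · intro x hx
      exact shiftKey_of_notMem (mt (hmap x) hx)
  have htot : Nat.card {j // u ∈ phaseStep G ident σ j A} +
      Nat.card {j // Joins (2 ^ m) R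
        (shiftKey (2 ^ m) (A.map φ) (fun x => x) fun x => σ j x) (φ u)} ≤ 2 ^ (2 * m + 8) := by
    rw [Nat.card_eq_fintype_card, Nat.card_eq_fintype_card, Fintype.card_subtype,
      Fintype.card_subtype, ← Finset.card_union_of_disjoint]
    · refine (Finset.card_le_univ _).trans (by simp)
    · rw [Finset.disjoint_filter]
      exact fun j _ h1 h2 => himp j h2 h1
  have h1 : ((Nat.card {j // u ∈ phaseStep G ident σ j A} : ℕ) : ℝ) + 2 ^ (2 * m + 4) ≤
      2 ^ (2 * m + 8) := by
    exact_mod_cast (Nat.add_le_add_left hmain _).trans htot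
  have h2 : (2 : ℝ) ^ (2 * m + 8) = 16 * 2 ^ (2 * m + 4) := by ring
  rw [h2] at h1 ⊢
  linarith

theorem one_sub_le_probBits_builds {m B T : ℕ → ℕ}
    {σ : ∀ n, (Fin (2 * m n + 8) → Bool) → Fin (2 ^ m n) → Fin (B n + 1)} {n : ℕ}
    (hσ : ∀ (R : Fin (2 ^ m n) → Finset (Fin (2 ^ m n))) (S : Finset (Fin (2 ^ m n)))
      (u : Fin (2 ^ m n)),
        (S.card : ℝ) * (2 * (1 / 2) ^ (B n - 1)) ≤ 1 / 2 → (∀ x ∉ S, R x = ∅) → u ∈ S →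
          2 ^ (2 * m n + 4) ≤ Nat.card {j // Joins (2 ^ m n) R
            (shiftKey (2 ^ m n) S (fun x => x) fun x => σ n j x) u})
    {ident : V → ℕ} (port : PortNumbering G) (hinj : Function.Injective ident)
    (hid : ∀ v, ident v < 2 ^ m n)
    (hcard : (Fintype.card V : ℝ) * (2 * (1 / 2) ^ (B n - 1)) ≤ 1 / 2) {numColors diam : ℕ}
    (hcol : T n ≤ numColors) (hdiam : 2 * B n ≤ diam) :
    1 - (15 / 16) ^ T n * (Fintype.card V : ℝ) ≤ probBits fun r =>
      (decompositionAlgorithm m B T σ).Builds n G ident port numColors diam 1 r := by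
  -- `X` counts the nodes left at the end. It is an integer, so a failure forces `1 ≤ X`, and its
  -- mean bounds the failure probability.
  set X : (Fin (T n * (2 * m n + 8)) → Bool) → ℝ := fun r =>
    (leftover (phaseStep G ident (σ n)) Finset.univ
      (extendSeeds (fun _ => false) (splitBits (T n) (2 * m n + 8) r)) (T n)).card with hX
  have hsum : ∑ r, X r ≤ (15 / 16 * 2 ^ (2 * m n + 8)) ^ T n * (Fintype.card V : ℝ) := by
    have h1 := sum_card_leftover_le (step := phaseStep G ident (σ n))
      (q := 15 / 16 * 2 ^ (2 * m n + 8)) (by positivity) Finset.univ phaseStep_subset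
      (fun S _ u hu => card_mem_phaseStep_le hσ hinj hid hcard hu) (fun _ => false) (T n)
    rw [Finset.card_univ] at h1
    exact ((splitBits (T n) (2 * m n + 8)).sum_comp fun J => ((leftover (phaseStep G ident (σ n))
      Finset.univ (extendSeeds (fun _ => false) J) (T n)).card : ℝ)).trans_le h1
  refine le_trans ?_ (one_sub_le_probBits (X := X) (fun r => Nat.cast_nonneg _) ?_)
  · rw [sub_le_sub_iff_left, div_le_iff₀ (by positivity)]
    refine hsum.trans (le_of_eq ?_)
    rw [mul_pow, ← pow_mul, mul_comm (2 * m n + 8) (T n)]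
    change _ = _ * (2 : ℝ) ^ (T n * (2 * m n + 8))
    ring
  · intro r hr
    by_contra hlt
    have hzero : leftover (phaseStep G ident (σ n)) Finset.univ
        (extendSeeds (fun _ => false) (splitBits (T n) (2 * m n + 8) r)) (T n) = ∅ := by
      rw [← Finset.card_eq_zero]
      have : ((leftover (phaseStep G ident (σ n)) Finset.univ (extendSeeds (fun _ => false)
        (splitBits (T n) (2 * m n + 8) r)) (T n)).card : ℝ) < 1 := not_le.mp hlt
      exact Nat.lt_one_iff.mp (by exact_mod_cast this)
    have hexec := isExecution_decompositionAlgorithm (σ := σ) (T := T) port hinj hid r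
    refine hr (hexec.exists_isNetworkDecomposition hcol hdiam fun v => ?_)
    rw [activeSet_eq_leftover hexec, hzero]
    simp

end Algorithm

theorem mainTheorem4 :
    ∃ e : ℕ, ∀ c : ℕ, ∃ K : ℕ, ∀ a : ℕ, ∃ (C : ℕ) (A : SharedRandomCongestAlgorithm),
      (∀ n : ℕ, 2 ≤ n →
        A.sharedBits n ≤ C * (Nat.log 2 n) ^ e ∧
        A.rounds n ≤ C * (Nat.log 2 n) ^ e ∧
        A.msgBits n ≤ C * Nat.log 2 n) ∧
      ∀ n : ℕ, 2 ≤ n →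
        ∀ (V : Type*) [Fintype V] (G : SimpleGraph V) [DecidableRel G.Adj]
          (ident : V → ℕ) (port : PortNumbering G),
          Fintype.card V ≤ n → Function.Injective ident → (∀ v, ident v < n ^ a) →
          1 - 1 / (n : ℝ) ^ c ≤ probBits (fun r =>
            A.Builds n G ident port (K * Nat.log 2 n) (K * (Nat.log 2 n) ^ 2) 1 r) := by
  refine ⟨2, fun c => ⟨32 * (c + 1), fun a => ?_⟩⟩
  choose σ hσ using fun n : ℕ =>
    exists_radiusTable (a * (Nat.log 2 n + 1)) (Nat.log 2 n + 4) (by omega)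
  -- With `L = Nat.log 2 n`, `n ≤ 2 ^ (L + 1)` shows that `a * (L + 1)` bits hold an identifier and
  -- that radius bound `L + 4` makes the union bound over `n` nodes at most `1 / 2`. Since `(15 /
  -- 16) ^ 16 ≤ 1 / 2`, the chosen number of phases leaves each node over with probability at most
  -- `n ^ (-(c + 1))`. The rounds give `448 = 16 * 2 * 14`.
  refine ⟨448 * (c + 1) * (a + 1), decompositionAlgorithm (fun n => a * (Nat.log 2 n + 1))
    (fun n => Nat.log 2 n + 4) (fun n => 16 * (c + 1) * (Nat.log 2 n + 1)) σ, ?_, ?_⟩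
  · intro n hn
    have hL : 1 ≤ Nat.log 2 n := Nat.log_pos (by norm_num) hn
    simp only [decompositionAlgorithm]
    generalize Nat.log 2 n = L at hL
    refine ⟨?_, ?_, ?_⟩
    · calc 16 * (c + 1) * (L + 1) * (2 * (a * (L + 1)) + 8)
          ≤ 16 * (c + 1) * (L + L) * (2 * (a * (L + L)) + 8 * L) := by
            gcongr
            omega
        _ = 64 * (c + 1) * (2 * a + 4) * L ^ 2 := by ring
        _ ≤ 64 * (c + 1) * (7 * (a + 1)) * L ^ 2 := by gcongr; omega
        _ = 448 * (c + 1) * (a + 1) * L ^ 2 := by ring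
    · calc 16 * (c + 1) * (L + 1) * (2 * (L + 4) + 4)
          ≤ 16 * (c + 1) * (L + L) * (14 * L) := by gcongr; omega
        _ = 448 * (c + 1) * 1 * L ^ 2 := by ring
        _ ≤ 448 * (c + 1) * (a + 1) * L ^ 2 := by gcongr; omega
    · calc 2 * (a * (L + 1) + (L + 4)) + 1 ≤ 2 * (a * (L + L) + (L + 4 * L)) + L := by
            gcongr
            omega
        _ = (4 * a + 11) * L := by ring
        _ ≤ 448 * (c + 1) * (a + 1) * L := by
          gcongr
          nlinarith [Nat.zero_le (c * a)]
  · intro n hn V _ G _ ident port hV hinj hid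
    have hL : 1 ≤ Nat.log 2 n := Nat.log_pos (by norm_num) hn
    have hnL : n ≤ 2 ^ (Nat.log 2 n + 1) := (Nat.lt_pow_succ_log_self (by norm_num) n).le
    have hid' : ∀ v, ident v < 2 ^ (a * (Nat.log 2 n + 1)) := fun v => by
      refine (hid v).trans_le ((Nat.pow_le_pow_left hnL a).trans_eq ?_)
      rw [← pow_mul, mul_comm]
    have hVL : (Fintype.card V : ℝ) ≤ 2 ^ (Nat.log 2 n + 1) := by exact_mod_cast hV.trans hnL
    have hcard : (Fintype.card V : ℝ) * (2 * (1 / 2) ^ (Nat.log 2 n + 4 - 1)) ≤ 1 / 2 := by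
      calc (Fintype.card V : ℝ) * (2 * (1 / 2) ^ (Nat.log 2 n + 4 - 1))
          ≤ 2 ^ (Nat.log 2 n + 1) * (2 * (1 / 2) ^ (Nat.log 2 n + 4 - 1)) := by gcongr
        _ = 2 ^ (Nat.log 2 n + 1) * (2 * (1 / 2) ^ (Nat.log 2 n + 3)) := rfl
        _ = (2 * (1 / 2)) ^ (Nat.log 2 n + 1) * (1 / 2) := by rw [mul_pow]; ring
        _ ≤ 1 / 2 := by norm_num
    refine le_trans ?_ (one_sub_le_probBits_builds
      (m := fun n => a * (Nat.log 2 n + 1)) (B := fun n => Nat.log 2 n + 4)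
      (T := fun n => 16 * (c + 1) * (Nat.log 2 n + 1)) (hσ n) port hinj hid' hcard ?_ ?_)
    · have hn0 : (0 : ℝ) < n := by positivity
      have hpow : (15 / 16 : ℝ) ^ (16 * (c + 1) * (Nat.log 2 n + 1)) ≤ 1 / (n : ℝ) ^ (c + 1) := by
        calc (15 / 16 : ℝ) ^ (16 * (c + 1) * (Nat.log 2 n + 1))
            = ((15 / 16 : ℝ) ^ 16) ^ ((Nat.log 2 n + 1) * (c + 1)) := by rw [← pow_mul]; ring_nf
          _ ≤ (1 / 2) ^ ((Nat.log 2 n + 1) * (c + 1)) := by gcongr; norm_num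
          _ = 1 / ((2 : ℝ) ^ (Nat.log 2 n + 1)) ^ (c + 1) := by
            rw [← pow_mul, one_div_pow]
          _ ≤ 1 / (n : ℝ) ^ (c + 1) := by
            gcongr
            exact_mod_cast hnL
      rw [sub_le_sub_iff_left]
      calc (15 / 16 : ℝ) ^ (16 * (c + 1) * (Nat.log 2 n + 1)) * (Fintype.card V : ℝ)
          ≤ 1 / (n : ℝ) ^ (c + 1) * n := by
            gcongr
        _ = 1 / (n : ℝ) ^ c := by
            rw [pow_succ]
            field_simp
    · calc 16 * (c + 1) * (Nat.log 2 n + 1) ≤ 16 * (c + 1) * (Nat.log 2 n + Nat.log 2 n) := by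
            gcongr
        _ = 32 * (c + 1) * Nat.log 2 n := by ring
    · generalize Nat.log 2 n = L at hL
      calc 2 * (L + 4) ≤ 32 * 1 * L ^ 2 := by nlinarith
        _ ≤ 32 * (c + 1) * L ^ 2 := by gcongr; omega
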